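/- A sensor has age of information $x(t)\in\{1,2,\dots\}$ and a channel state $q(t)$ that is an irreducible (for instance, an ergodic) Markov chain on a finite non-empty set $\mathcal Q$ with transition matrix $(p_{q,q'})$. In each slot $t=1,2,\dots$ a decision $s(t)\in\{0,1\}$ is taken; if $s(t)=1$ then $x(t+1)=1$, and if $s(t)=0$ then $x(t+1)=x(t)+1$; the channel evolves independently of the decisions. Initially $x(1)=1$, and $q(1)$ has an arbitrary law $\nu$. Fix $W\ge 0$, powers $\omega(q)\ge 0$ and a budget $\mathcal E>0$. A non-anticipated policy chooses $s(t)=1$ with a probability depending on the present and past ages and channel states; it is feasible if $\limsup_{T}\frac1T\mathbb E\sum_{t=1}^T \omega(q(t))s(t)\le\mathcal E$, and its cost is $\limsup_{T}\frac1T\mathbb E\sum_{t=1}^T (x(t)+W s(t))$. A policy is optimal (for $\nu$) if it is feasible and its cost is minimal among all feasible non-anticipated policies. A stationary randomized policy is given by probabilities $\xi_{x,q}\in[0,1]$ of scheduling in state $(x,q)$. Then the optimal stationary randomized scheduling probabilities are nondecreasing in the age, in the following sense. (1) For every law $\nu$, if a stationary randomized policy $\xi^*$ is optimal for $\nu$,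 then for every channel state $q$ and all $1\le x_1<x_2$ such that, under $\xi^*$, the states $(x_1,q)$ and $(x_2,q)$ are visited with positive long-run frequency $\limsup_T \frac1T\sum_{t=1}^T\Pr\big((x(t),q(t))=(x_i,q)\big)>0$, we have $\xi^*_{x_1,q}\le\xi^*_{x_2,q}$. (2) There is a stationary randomized policy $\xi^*$ with $\xi^*_{x_1,q}\le \xi^*_{x_2,q}$ for every channel state $q$ and all $1\le x_1<x_2$, and with a steady-state distribution $\mu^*$, such that $\xi^*$ is optimal in the steady state $\mu^*$: $\sum_{x,q}\mu^*_{x,q}\xi^*_{x,q}\omega(q)\le\mathcal E$, and $\sum_{x,q}\mu^*_{x,q}(x+W\xi^*_{x,q})$ is at most the cost of every feasible non-anticipated policy, for every law $\nu$. If $\mu^*$ is the only steady-state distribution under $\xi^*$, then $\xi^*$ is moreover optimal for every law $\nu$. -/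

import Mathlib

open Filter

namespace AoI

/-- A (randomized, history dependent) scheduling rule. `π h x q` is the probability of scheduling
the sensor in the current slot when the current Age of Information is `x`, the current channel
state is `q`, and `h` is the list of the past pairs (AoI, channel state), most recent first.
The past decisions are functions of the past and current ages, since the age is `1` exactly after
a transmission. -/
abbrev Rule (Ch : Type*) := List (ℕ × Ch) → ℕ → Ch → ℝ

/-- A non-anticipated policy: a rule whose values are probabilities. -/
def IsPolicy {Ch : Type*} (π : Rule Ch) : Prop := ∀ h x q, π h x q ∈ Set.Icc (0 : ℝ) 1

/-- A stationary randomized policy: scheduling probabilities `ξ x q` that depend only on the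
current age `x` and channel state `q`. -/
def IsStationaryPolicy {Ch : Type*} (ξ : ℕ → Ch → ℝ) : Prop := ∀ x q, ξ x q ∈ Set.Icc (0 : ℝ) 1

/-- The stationary randomized policy as a history dependent rule that ignores the past. -/
def stationary {Ch : Type*} (ξ : ℕ → Ch → ℝ) : Rule Ch := fun _ x q => ξ x q

/-- The expected total of the one-step cost `c` over the next `T` slots, under the rule `π`, from
the current age `x` and channel state `q` with past `h`. In a slot the sensor is scheduled with
probability `π h x q`, and then the age becomes `1`; otherwise the age becomes `x + 1`. In both
cases the channel moves from `q` to `q'` with probability `p q q'`. -/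
def expTotal {Ch : Type*} [Fintype Ch] (p : Matrix Ch Ch ℝ) (π : Rule Ch)
    (c : ℕ → Ch → Bool → ℝ) : ℕ → List (ℕ × Ch) → ℕ → Ch → ℝ
  | 0, _, _, _ => 0
  | T + 1, h, x, q =>
      π h x q * (c x q true + ∑ q', p q q' * expTotal p π c T ((x, q) :: h) 1 q')
        + (1 - π h x q)
          * (c x q false + ∑ q', p q q' * expTotal p π c T ((x, q) :: h) (x + 1) q')

/-- The expected average of `c` over the first `T` slots, when the initial age is `1` and the
initial channel state has law `ν`. -/
noncomputable def expAverage {Ch : Type*} [Fintype Ch] (p : Matrix Ch Ch ℝ) (ν : Ch → ℝ)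
    (π : Rule Ch) (c : ℕ → Ch → Bool → ℝ) (T : ℕ) : ℝ :=
  (∑ q, ν q * expTotal p π c T [] 1 q) / T

/-- The long-run expected average of `c` (an upper limit, in the extended reals). -/
noncomputable def longRun {Ch : Type*} [Fintype Ch] (p : Matrix Ch Ch ℝ) (ν : Ch → ℝ)
    (π : Rule Ch) (c : ℕ → Ch → Bool → ℝ) : EReal :=
  limsup (fun T : ℕ => ((expAverage p ν π c T : ℝ) : EReal)) atTop

/-- One-step cost: age plus scheduling penalty, `x + W s`. -/
def ageCost {Ch : Type*} (W : ℝ) : ℕ → Ch → Bool → ℝ :=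
  fun x _ s => (x : ℝ) + if s then W else 0

/-- One-step power consumption, `ω(q) s`. -/
def powerCost {Ch : Type*} (ω : Ch → ℝ) : ℕ → Ch → Bool → ℝ :=
  fun _ q s => if s then ω q else 0

/-- Indicator of the state `(x₀, q₀)`. -/
noncomputable def visit {Ch : Type*} [DecidableEq Ch] (x₀ : ℕ) (q₀ : Ch) : ℕ → Ch → Bool → ℝ :=
  fun x q _ => if x = x₀ ∧ q = q₀ then 1 else 0

/-- `π` is a non-anticipated policy that meets the average power constraint. -/
structure IsFeasible {Ch : Type*} [Fintype Ch] (p : Matrix Ch Ch ℝ) (ω : Ch → ℝ) (E : ℝ)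
    (ν : Ch → ℝ) (π : Rule Ch) : Prop where
  policy : IsPolicy π
  power : longRun p ν π (powerCost ω) ≤ (E : EReal)

/-- `π` solves the power constrained single-sensor problem: it is feasible, and no feasible
non-anticipated policy has a smaller long-run average cost. -/
structure IsOptimal {Ch : Type*} [Fintype Ch] (p : Matrix Ch Ch ℝ) (ω : Ch → ℝ) (E W : ℝ)
    (ν : Ch → ℝ) (π : Rule Ch) : Prop where
  feasible : IsFeasible p ω E ν π
  le : ∀ π', IsFeasible p ω E ν π' →
    longRun p ν π (ageCost W) ≤ longRun p ν π' (ageCost W)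

/-- `μ` is a steady-state distribution of (age, channel state) under the scheduling
probabilities `ξ`; the ages are `1, 2, …`. -/
structure IsSteadyState {Ch : Type*} [Fintype Ch] (p : Matrix Ch Ch ℝ) (ξ : ℕ → Ch → ℝ)
    (μ : ℕ → Ch → ℝ) : Prop where
  nonneg : ∀ x q, 0 ≤ μ x q
  age_zero : ∀ q, μ 0 q = 0
  total : HasSum (fun s : ℕ × Ch => μ s.1 s.2) 1
  reset : ∀ q', HasSum (fun s : ℕ × Ch => μ s.1 s.2 * ξ s.1 s.2 * p s.2 q') (μ 1 q')
  step : ∀ x, 1 ≤ x → ∀ q', μ (x + 1) q' = ∑ q, μ x q * (1 - ξ x q) * p q q'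

/-- In the steady state `μ`, the scheduling probabilities `ξ` meet the power constraint, and their
mean cost is at most the long-run average cost of every feasible non-anticipated policy, for every
law of the initial channel state. -/
def IsSteadyOptimal {Ch : Type*} [Fintype Ch] (p : Matrix Ch Ch ℝ) (ω : Ch → ℝ) (E W : ℝ)
    (ξ μ : ℕ → Ch → ℝ) : Prop :=
  IsSteadyState p ξ μ ∧
    (∃ e : ℝ, HasSum (fun s : ℕ × Ch => μ s.1 s.2 * ξ s.1 s.2 * ω s.2) e ∧ e ≤ E) ∧
    ∃ c : ℝ, HasSum (fun s : ℕ × Ch => μ s.1 s.2 * ((s.1 : ℝ) + W * ξ s.1 s.2)) c ∧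
      ∀ ν ∈ stdSimplex ℝ Ch, ∀ π, IsFeasible p ω E ν π → (c : EReal) ≤ longRun p ν π (ageCost W)

end AoI

/-! Lagrangian duality removes the power constraint. Let `l ≥ 0` be a price of power and `Φ` a
relative value function for the cost `x + W s + l ω(q) s` with mean `g`. The loss of an action is
the amount by which it misses equality in the optimality inequality; both losses are nonnegative.
The loss of transmitting minus that of waiting is `W + l ω(q) + ∑ p Φ(1, ·) - ∑ p Φ(x + 1, ·)`. It
strictly decreases in the age because `Φ` has slope at least one (`loss_strictAnti`). So each
channel state has a threshold, and randomizing without loss is possible at one age at most.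

By a drift argument (`average_bound`, `loss_le`) a feasible policy costs at least `g - l E` plus its
mean loss at any one state. A stationary policy attaining `g - l E` therefore acts without loss
wherever it is visited with positive frequency, which forces monotonicity there.

A certificate whose value is attained comes from the linear program over state-action frequencies
with ages up to `n + 1`. A Slater point bounds its multipliers `l` and `g` independently of `n`, and
irreducibility bounds the oscillation of `V` at age one. For large `n` the age limit is then
harmless, and an optimal stopping problem extends the multipliers to all ages
(`exists_isCertificate`, `exists_optimal_frequencies`). By complementary slackness the optimal
frequencies are lossless, and unvisited states are filled in by comparing losses.

The optimal frequencies may have several recurrent classes and need not be reached from a given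
initial law. A small admixture of frequencies charging every transmission cures this at vanishing
cost (`longRun_le_of_isOptimal`), so an optimal policy does attain `g - l E`. -/

namespace AoI

open Matrix Topology

/-! ### Linear programming duality -/

/-- Farkas' lemma for finitely many linear functionals on a real vector space. -/
theorem exists_nonneg_combination {X ι : Type*} [AddCommGroup X] [Module ℝ X] [DecidableEq ι]
    (s : Finset ι) (a : ι → X →ₗ[ℝ] ℝ) (c : X →ₗ[ℝ] ℝ)
    (h : ∀ x, (∀ i ∈ s, a i x ≤ 0) → c x ≤ 0) :
    ∃ u : ι → ℝ, (∀ i, 0 ≤ u i) ∧ ∀ x, c x = ∑ i ∈ s, u i * a i x := by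
  induction s using Finset.induction_on generalizing a c with
  | empty =>
    refine ⟨0, fun _ => le_rfl, fun x => ?_⟩
    have h1 := h x (by simp)
    have h2 := h (-x) (by simp)
    simp only [map_neg] at h2
    simp only [Finset.sum_empty]
    linarith
  | insert j s hj ih =>
    by_cases hs : ∀ x, (∀ i ∈ s, a i x ≤ 0) → c x ≤ 0
    · obtain ⟨u, hu, hc⟩ := ih a c hs
      refine ⟨fun i => if i = j then 0 else u i, fun i => ?_, fun x => ?_⟩
      · dsimp only
        split_ifs
        exacts [le_rfl, hu i]
      · rw [Finset.sum_insert hj, hc x]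
        simp only [if_true, zero_mul, zero_add]
        refine Finset.sum_congr rfl fun i hi => ?_
        rw [if_neg (ne_of_mem_of_not_mem hi hj)]
    · push Not at hs
      obtain ⟨x₁, hx₁, hcx₁⟩ := hs
      have hjx₁ : 0 < a j x₁ := by
        by_contra hneg
        push Not at hneg
        refine absurd (h x₁ fun i hi => ?_) (not_le.2 hcx₁)
        rcases Finset.mem_insert.1 hi with rfl | hi
        exacts [hneg, hx₁ i hi]
      -- After scaling, `x ↦ x - a j x • x₀` projects onto the kernel of `a j`. The induction
      -- hypothesis is applied to the functionals composed with this projection.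
      obtain ⟨x₀, hx₀, hcx₀, hjx₀⟩ :
          ∃ x₀, (∀ i ∈ s, a i x₀ ≤ 0) ∧ 0 < c x₀ ∧ a j x₀ = 1 := by
        refine ⟨(a j x₁)⁻¹ • x₁, fun i hi => ?_, ?_, ?_⟩
        · simpa using mul_nonpos_of_nonneg_of_nonpos (inv_nonneg.2 hjx₁.le) (hx₁ i hi)
        · simpa using mul_pos (inv_pos.2 hjx₁) hcx₁
        · simp [hjx₁.ne']
      obtain ⟨u, hu, hc⟩ := ih (fun i => a i - a i x₀ • a j) (c - c x₀ • a j) (by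
        intro x hx
        have := h (x - a j x • x₀) (by
          intro i hi
          rcases Finset.mem_insert.1 hi with rfl | hi
          · simp [hjx₀]
          · have := hx i hi
            simp only [LinearMap.sub_apply, LinearMap.smul_apply, smul_eq_mul] at this
            simp only [map_sub, map_smul, smul_eq_mul]
            linarith)
        simp only [map_sub, map_smul, smul_eq_mul] at this
        simp only [LinearMap.sub_apply, LinearMap.smul_apply, smul_eq_mul]
        linarith)
      refine ⟨fun i => if i = j then c x₀ - ∑ i ∈ s, u i * a i x₀ else u i, fun i => ?_,
        fun x => ?_⟩
      · dsimp only
        split_ifs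
        · have : ∑ i ∈ s, u i * a i x₀ ≤ 0 :=
            Finset.sum_nonpos fun i hi => mul_nonpos_of_nonneg_of_nonpos (hu i) (hx₀ i hi)
          linarith
        · exact hu i
      · rw [Finset.sum_insert hj]
        have h1 := hc x
        simp only [LinearMap.sub_apply, LinearMap.smul_apply, smul_eq_mul, mul_sub,
          Finset.sum_sub_distrib] at h1
        have h2 : ∑ i ∈ s, (if i = j then c x₀ - ∑ i ∈ s, u i * a i x₀ else u i) * a i x
            = ∑ i ∈ s, u i * a i x :=
          Finset.sum_congr rfl fun i hi => by rw [if_neg (ne_of_mem_of_not_mem hi hj)]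
        have h3 : ∑ i ∈ s, u i * (a i x₀ * a j x) = (∑ i ∈ s, u i * a i x₀) * a j x := by
          rw [Finset.sum_mul]
          exact Finset.sum_congr rfl fun i _ => by ring
        rw [h2]
        simp only [if_true]
        linarith

/-- Feasible points of a linear program over the simplex, with equality constraints `R` and one
budget constraint. -/
structure IsLPFeasible {ι κ : Type*} [Fintype ι] (R : ι → κ → ℝ) (w : ι → ℝ) (E : ℝ)
    (z : ι → ℝ) : Prop where
  nonneg : ∀ i, 0 ≤ z i
  total : ∑ i, z i = 1
  eq : ∀ k, ∑ i, z i * R i k = 0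
  budget : ∑ i, z i * w i ≤ E

theorem IsLPFeasible.exists_minimizer {ι κ : Type*} [Fintype ι]
    {R : ι → κ → ℝ} {w : ι → ℝ} {E : ℝ} {z₀ : ι → ℝ} (h₀ : IsLPFeasible R w E z₀) (c : ι → ℝ) :
    ∃ z, IsLPFeasible R w E z ∧
      ∀ z', IsLPFeasible R w E z' → ∑ i, z i * c i ≤ ∑ i, z' i * c i := by
  have hcomp : IsCompact {z | IsLPFeasible R w E z} := by
    have hclosed : IsClosed ({z : ι → ℝ | ∀ k, ∑ i, z i * R i k = 0} ∩ {z : ι → ℝ | ∑ i, z i * w i ≤ E}) := by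
      refine IsClosed.inter ?_ (isClosed_le (by fun_prop) continuous_const)
      simp only [Set.ofPred_forall]
      exact isClosed_iInter fun k => isClosed_eq (by fun_prop) continuous_const
    convert (isCompact_stdSimplex ℝ ι).inter_right hclosed using 1
    ext z
    constructor
    · exact fun h => ⟨⟨h.nonneg, h.total⟩, h.eq, h.budget⟩
    · exact fun h => ⟨h.1.1, h.1.2, h.2.1, h.2.2⟩
  obtain ⟨z, hz, hmin⟩ := hcomp.exists_isMinOn ⟨z₀, h₀⟩
    (f := fun z : ι → ℝ => ∑ i, z i * c i) (by fun_prop)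
  exact ⟨z, hz, fun z' hz' => hmin hz'⟩

/-- Strong duality for the linear program: a minimizer comes with multipliers `V` of the equality
constraints, `g` of the total mass and `l` of the budget. -/
theorem IsLPFeasible.exists_multipliers {ι κ : Type*} [Fintype ι] [Fintype κ] [DecidableEq ι]
    [DecidableEq κ] {R : ι → κ → ℝ} {w : ι → ℝ} {E : ℝ} {z : ι → ℝ} {c : ι → ℝ}
    (hmin : ∀ z', IsLPFeasible R w E z' → ∑ i, z i * c i ≤ ∑ i, z' i * c i) :
    ∃ (V : κ → ℝ) (g l : ℝ), 0 ≤ l ∧ ∑ i, z i * c i + l * E ≤ g ∧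
      ∀ i, g ≤ c i + l * w i + ∑ k, V k * R i k := by
  set C := ∑ i, z i * c i with hC
  by_contra hno
  push Not at hno
  -- The dual system is homogenized by a scale `s`, in coordinates `(V, g, l, s)`. A point of the
  -- cone with `s > 0` would divide to multipliers, so `s ≤ 0` there and Farkas' lemma applies.
  let a : Option (Option ι) → ((κ → ℝ) × ℝ × ℝ × ℝ) →ₗ[ℝ] ℝ := fun o =>
    match o with
    | none =>
      { toFun := fun x => x.2.2.2 * C - x.2.1 + x.2.2.1 * E
        map_add' := fun x y => by simp; ring
        map_smul' := fun r x => by simp; ring }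
    | some none =>
      { toFun := fun x => -x.2.2.1
        map_add' := fun x y => by simp; ring
        map_smul' := fun r x => by simp }
    | some (some i) =>
      { toFun := fun x => x.2.1 - x.2.2.1 * w i - x.2.2.2 * c i - ∑ k, x.1 k * R i k
        map_add' := fun x y => by simp [add_mul, Finset.sum_add_distrib]; ring
        map_smul' := fun r x => by simp [mul_assoc, ← Finset.mul_sum]; ring }
  let t : ((κ → ℝ) × ℝ × ℝ × ℝ) →ₗ[ℝ] ℝ :=
    { toFun := fun x => x.2.2.2
      map_add' := fun x y => by simp
      map_smul' := fun r x => by simp }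
  obtain ⟨u, hu, hut⟩ := exists_nonneg_combination Finset.univ a t (by
    rintro ⟨V, g, l, s⟩ hx
    change s ≤ 0
    by_contra hs
    push Not at hs
    have h1 : s * C - g + l * E ≤ 0 := hx none (Finset.mem_univ _)
    have h2 : -l ≤ 0 := hx (some none) (Finset.mem_univ _)
    have h3 : ∀ i, g - l * w i - s * c i - ∑ k, V k * R i k ≤ 0 :=
      fun i => hx (some (some i)) (Finset.mem_univ _)
    obtain ⟨i, hi⟩ := hno (fun k => V k / s) (g / s) (l / s) (div_nonneg (by linarith) hs.le) (by
      rw [div_mul_eq_mul_div, le_div_iff₀ hs, add_mul, div_mul_cancel₀ _ hs.ne']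
      linarith)
    have h4 : ∑ k, V k / s * R i k = (∑ k, V k * R i k) / s := by
      rw [Finset.sum_div]
      exact Finset.sum_congr rfl fun k _ => by ring
    rw [h4, lt_div_iff₀ hs, add_mul, add_mul, div_mul_cancel₀ _ hs.ne', div_mul_eq_mul_div,
      div_mul_cancel₀ _ hs.ne'] at hi
    linarith [h3 i])
  have key : ∀ (V : κ → ℝ) (g l s : ℝ), s = u none * (s * C - g + l * E) + (u (some none) * (-l) +
      ∑ i, u (some (some i)) * (g - l * w i - s * c i - ∑ k, V k * R i k)) := by
    intro V g l s
    have := hut (V, g, l, s)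
    rwa [Fintype.sum_option, Fintype.sum_option] at this
  set v : ι → ℝ := fun i => u (some (some i)) with hv
  have hv0 : ∀ i, 0 ≤ v i := fun i => hu _
  have hg : ∑ i, v i = u none := by
    have := key 0 1 0 0
    simp at this
    linarith
  have hl : ∑ i, v i * w i ≤ u none * E := by
    have := key 0 0 1 0
    simp at this
    linarith [hu (some none)]
  have hs : ∑ i, v i * c i = u none * C - 1 := by
    have := key 0 0 0 1
    simp at this
    linarith
  have hV : ∀ k, ∑ i, v i * R i k = 0 := by
    intro k
    have := key (Pi.single k 1) 0 0 0
    simp [Pi.single_apply] at this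
    linarith
  -- Mass zero forces `v = 0`, against the cost `-1`. Otherwise the normalized weights are feasible
  -- and cheaper than `C`.
  rcases (hu none).eq_or_lt with h0 | hpos
  · have hz : ∀ i, v i = 0 := by
      rw [← h0] at hg
      exact fun i => (Finset.sum_eq_zero_iff_of_nonneg fun i _ => hv0 i).1 hg i (Finset.mem_univ i)
    simp only [hz, zero_mul, Finset.sum_const_zero, ← h0] at hs
    linarith
  · have hsc : ∀ f : ι → ℝ, ∑ i, v i / u none * f i = (∑ i, v i * f i) / u none := by
      intro f
      rw [Finset.sum_div]
      exact Finset.sum_congr rfl fun k _ => by ring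
    have := hmin (fun i => v i / u none)
      { nonneg := fun i => div_nonneg (hv0 i) hpos.le
        total := by rw [← Finset.sum_div, hg, div_self hpos.ne']
        eq := fun k => by rw [hsc, hV, zero_div]
        budget := by rw [hsc, div_le_iff₀ hpos]; linarith }
    rw [hsc, hs, le_div_iff₀ hpos] at this
    linarith

/-! ### Finite Markov chains: averages, uniqueness, irreducibility -/

section Markov

variable {S : Type*} [Fintype S] [DecidableEq S]

theorem vecMul_mem_stdSimplex {M : Matrix S S ℝ} (hM : M ∈ rowStochastic ℝ S) {v : S → ℝ}
    (hv : v ∈ stdSimplex ℝ S) : v ᵥ* M ∈ stdSimplex ℝ S := by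
  refine ⟨nonneg_vecMul_of_mem_rowStochastic hM hv.1, ?_⟩
  have := vecMul_dotProduct_one_eq_one_rowStochastic (x := v) hM (by simpa [dotProduct] using hv.2)
  simpa [dotProduct] using this

theorem pow_mem_rowStochastic {M : Matrix S S ℝ} (hM : M ∈ rowStochastic ℝ S) (t : ℕ) :
    M ^ t ∈ rowStochastic ℝ S := pow_mem hM t

/-- The time averages of the laws of a Markov chain started from `v`. -/
noncomputable def cesaro (M : Matrix S S ℝ) (v : S → ℝ) (T : ℕ) : S → ℝ :=
  (T : ℝ)⁻¹ • ∑ t ∈ Finset.range T, v ᵥ* M ^ t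

theorem cesaro_mem_stdSimplex {M : Matrix S S ℝ} (hM : M ∈ rowStochastic ℝ S) {v : S → ℝ}
    (hv : v ∈ stdSimplex ℝ S) {T : ℕ} (hT : 0 < T) : cesaro M v T ∈ stdSimplex ℝ S := by
  have h := fun t => vecMul_mem_stdSimplex (pow_mem_rowStochastic hM t) hv
  have hT' : (T : ℝ) ≠ 0 := by positivity
  refine ⟨fun i => ?_, ?_⟩
  · simp only [cesaro, Pi.smul_apply, Finset.sum_apply, smul_eq_mul]
    exact mul_nonneg (by positivity) (Finset.sum_nonneg fun t _ => (h t).1 i)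
  · simp only [cesaro, Pi.smul_apply, Finset.sum_apply, smul_eq_mul]
    rw [← Finset.mul_sum, Finset.sum_comm, Finset.sum_congr rfl fun t _ => (h t).2]
    simp [hT']

/-- The sum telescopes: one step changes the average by `(v M^T - v) / T`. -/
theorem tendsto_cesaro_vecMul_sub {M : Matrix S S ℝ} (hM : M ∈ rowStochastic ℝ S) {v : S → ℝ}
    (hv : v ∈ stdSimplex ℝ S) :
    Tendsto (fun T => cesaro M v T ᵥ* M - cesaro M v T) atTop (𝓝 0) := by
  have h := fun t => vecMul_mem_stdSimplex (pow_mem_rowStochastic hM t) hv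
  have heq : ∀ T, cesaro M v T ᵥ* M - cesaro M v T = (T : ℝ)⁻¹ • (v ᵥ* M ^ T - v) := by
    intro T
    rw [cesaro, smul_vecMul, ← smul_sub, Matrix.sum_vecMul, ← Finset.sum_sub_distrib]
    congr 1
    have := Finset.sum_range_sub (fun t => v ᵥ* M ^ t) T
    simp only [pow_zero, vecMul_one] at this
    rw [← this]
    exact Finset.sum_congr rfl fun t _ => by rw [vecMul_vecMul, pow_succ]
  simp only [heq]
  rw [tendsto_pi_nhds]
  intro i
  refine squeeze_zero_norm (a := fun T : ℕ => (T : ℝ)⁻¹) (fun T => ?_)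
    tendsto_inv_atTop_nhds_zero_nat
  have h1 : ∀ w ∈ stdSimplex ℝ S, w i ∈ Set.Icc (0 : ℝ) 1 := fun w hw =>
    ⟨hw.1 i, by rw [← hw.2]; exact Finset.single_le_sum (fun j _ => hw.1 j) (Finset.mem_univ i)⟩
  have h2 := h1 _ (h T)
  have h3 := h1 _ hv
  simp only [Pi.smul_apply, Pi.sub_apply, smul_eq_mul, norm_mul, Real.norm_eq_abs]
  rw [abs_of_nonneg (by positivity : (0 : ℝ) ≤ (T : ℝ)⁻¹)]
  refine mul_le_of_le_one_right (by positivity) (abs_le.2 ⟨?_, ?_⟩) <;>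
    linarith [h2.1, h2.2, h3.1, h3.2]

theorem vecMul_eq_of_mapClusterPt_cesaro {M : Matrix S S ℝ} (hM : M ∈ rowStochastic ℝ S)
    {v x : S → ℝ} (hv : v ∈ stdSimplex ℝ S) (hx : MapClusterPt x atTop (cesaro M v)) :
    x ᵥ* M = x := by
  have hF : Continuous fun y : S → ℝ => y ᵥ* M - y := by fun_prop
  have h1 := hx.continuousAt_comp hF.continuousAt
  have h2 := tendsto_cesaro_vecMul_sub hM hv
  have h3 : x ᵥ* M - x = 0 := by
    have : ClusterPt (x ᵥ* M - x) (𝓝 0) := ClusterPt.mono h1 h2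
    exact eq_of_nhds_neBot this
  exact sub_eq_zero.1 h3

theorem exists_stationary {M : Matrix S S ℝ} (hM : M ∈ rowStochastic ℝ S) [Nonempty S] :
    ∃ m ∈ stdSimplex ℝ S, m ᵥ* M = m := by
  obtain ⟨s⟩ := ‹Nonempty S›
  have hv := single_mem_stdSimplex ℝ s
  obtain ⟨x, hx, hcl⟩ := (isCompact_stdSimplex ℝ S).exists_mapClusterPt_of_frequently (l := atTop)
    (f := cesaro M (Pi.single s 1))
    ((eventually_gt_atTop 0).mono fun T hT => cesaro_mem_stdSimplex hM hv hT).frequently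
  exact ⟨x, hx, vecMul_eq_of_mapClusterPt_cesaro hM hv hcl⟩

theorem tendsto_cesaro {M : Matrix S S ℝ} (hM : M ∈ rowStochastic ℝ S) {v m : S → ℝ}
    (hv : v ∈ stdSimplex ℝ S) (huniq : ∀ m' ∈ stdSimplex ℝ S, m' ᵥ* M = m' → m' = m) :
    Tendsto (cesaro M v) atTop (𝓝 m) :=
  (isCompact_stdSimplex ℝ S).tendsto_nhds_of_unique_mapClusterPt
    ((eventually_gt_atTop 0).mono fun _ hT => cesaro_mem_stdSimplex hM hv hT)
    fun x hx hcl => huniq x hx (vecMul_eq_of_mapClusterPt_cesaro hM hv hcl)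

/-- The positive part of an invariant signed measure is invariant. -/
theorem posPart_vecMul_eq {M : Matrix S S ℝ} (hM : M ∈ rowStochastic ℝ S) {d : S → ℝ}
    (hd : d ᵥ* M = d) : (fun i => max (d i) 0) ᵥ* M = fun i => max (d i) 0 := by
  -- The positive part lies below its image, and `M` preserves total mass, so the two coincide.
  have hle : ∀ j, max (d j) 0 ≤ ((fun i => max (d i) 0) ᵥ* M) j := by
    intro j
    refine max_le ?_ (nonneg_vecMul_of_mem_rowStochastic hM (fun i => le_max_right _ _) j)
    conv_lhs => rw [← hd]
    exact Finset.sum_le_sum fun i _ => mul_le_mul_of_nonneg_right (le_max_left _ _)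
      (nonneg_of_mem_rowStochastic hM)
  have hsum : ∑ j, max (d j) 0 = ∑ j, ((fun i => max (d i) 0) ᵥ* M) j := by
    simp only [vecMul, dotProduct]
    rw [Finset.sum_comm]
    exact Finset.sum_congr rfl fun i _ => by
      rw [← Finset.mul_sum, sum_row_of_mem_rowStochastic hM, mul_one]
  funext j
  exact ((Finset.sum_eq_sum_iff_of_le fun j _ => hle j).1 hsum j (Finset.mem_univ j)).symm

/-- The stationary distribution is unique if some state is charged by every nonzero invariant
measure. -/
theorem stationary_unique {M : Matrix S S ℝ} (hM : M ∈ rowStochastic ℝ S) (s : S)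
    (hs : ∀ r : S → ℝ, (∀ i, 0 ≤ r i) → r ᵥ* M = r → (∃ i, 0 < r i) → 0 < r s)
    {m m' : S → ℝ} (hm : m ∈ stdSimplex ℝ S) (hm' : m' ∈ stdSimplex ℝ S)
    (hmM : m ᵥ* M = m) (hmM' : m' ᵥ* M = m') : m' = m := by
  have key : ∀ d : S → ℝ, d ᵥ* M = d → (∃ i, 0 < d i) → 0 < d s := by
    rintro d hd ⟨i, hi⟩
    have := hs _ (fun i => le_max_right (d i) 0) (posPart_vecMul_eq hM hd) ⟨i, lt_max_of_lt_left hi⟩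
    simpa using this
  have hd : (m' - m) ᵥ* M = m' - m := by rw [sub_vecMul, hmM, hmM']
  have hd' : (m - m') ᵥ* M = m - m' := by rw [sub_vecMul, hmM, hmM']
  have hsum : ∑ i, m i = ∑ i, m' i := by rw [hm.2, hm'.2]
  -- By `key`, `m' - m` and `m - m'` cannot both have a positive entry. The two laws are thus
  -- ordered, and equal mass makes them equal.
  by_cases h : ∃ i, 0 < (m' - m) i
  · have h1 := key _ hd h
    have h2 : ∀ i, m i ≤ m' i := by
      intro i
      by_contra hi
      have := key _ hd' ⟨i, by simpa using hi⟩
      simp only [Pi.sub_apply] at h1 this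
      linarith
    exact (funext fun i =>
      (Finset.sum_eq_sum_iff_of_le fun j _ => h2 j).1 hsum i (Finset.mem_univ i)).symm
  · push Not at h
    have h2 : ∀ i, m' i ≤ m i := fun i => by simpa using h i
    exact funext fun i =>
      (Finset.sum_eq_sum_iff_of_le fun j _ => h2 j).1 hsum.symm i (Finset.mem_univ i)

theorem exists_pos_of_mem_stdSimplex {S : Type*} [Fintype S] {v : S → ℝ}
    (hv : v ∈ stdSimplex ℝ S) : ∃ i, 0 < v i := by
  by_contra h
  push Not at h
  have : ∑ i, v i ≤ 0 := Finset.sum_nonpos fun i _ => h i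
  linarith [hv.2]

/-- Positivity propagates along an irreducible matrix. -/
theorem pos_of_isIrreducible {p : Matrix S S ℝ} (hirr : p.IsIrreducible) {P : S → Prop}
    (hstep : ∀ i j, P i → 0 < p i j → P j) {i : S} (hi : P i) (j : S) : P j := by
  have hpow : ∀ (k : ℕ) (j : S), 0 < (p ^ k) i j → P j := by
    intro k
    induction k with
    | zero =>
      intro j hj
      rcases eq_or_ne i j with rfl | hne
      · exact hi
      · simp [hne] at hj
    | succ k ih =>
      intro j hj
      rw [pow_succ, mul_apply] at hj
      obtain ⟨l, -, hl⟩ := Finset.exists_lt_of_sum_lt (s := Finset.univ) (f := fun _ : S => (0 : ℝ))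
        (by simpa using hj)
      have h1 := pow_apply_nonneg hirr.nonneg k i l
      have h2 := hirr.nonneg l j
      have h1' : 0 < (p ^ k) i l := h1.lt_of_ne' fun h => by simp [h] at hl
      have h2' : 0 < p l j := h2.lt_of_ne' fun h => by simp [h] at hl
      exact hstep l j (ih l h1') h2'
  obtain ⟨k, -, hk⟩ := (isIrreducible_iff_exists_pow_pos hirr.nonneg).1 hirr i j
  exact hpow k j hk

theorem exists_pos_stationary [Nonempty S] {p : Matrix S S ℝ} (hp : p ∈ rowStochastic ℝ S)
    (hirr : p.IsIrreducible) : ∃ m ∈ stdSimplex ℝ S, m ᵥ* p = m ∧ ∀ i, 0 < m i := by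
  obtain ⟨m, hm, hmp⟩ := exists_stationary hp
  obtain ⟨i, hi⟩ := exists_pos_of_mem_stdSimplex hm
  refine ⟨m, hm, hmp, pos_of_isIrreducible hirr (fun i j hi hij => ?_) hi⟩
  rw [← hmp]
  exact Finset.sum_pos' (fun l _ => mul_nonneg (hm.1 l) (hirr.nonneg l j))
    ⟨i, Finset.mem_univ i, mul_pos hi hij⟩

/-- A function that exceeds its mean after one step by at most `b` has oscillation at most `K b`,
with `K` depending on the chain only. -/
theorem exists_oscillation_bound [Nonempty S] {p : Matrix S S ℝ} (hp : p ∈ rowStochastic ℝ S)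
    (hirr : p.IsIrreducible) : ∃ K : ℝ, 0 ≤ K ∧ ∀ (b : ℝ) (v : S → ℝ), 0 ≤ b →
      (∀ i, v i ≤ b + ∑ j, p i j * v j) → ∀ i j, v i - v j ≤ K * b := by
  choose k hk hpos using (isIrreducible_iff_exists_pow_pos hirr.nonneg).1 hirr
  have hterm : ∀ i j, 0 ≤ (k i j : ℝ) / (p ^ k i j) i j := fun i j =>
    div_nonneg (Nat.cast_nonneg _) (hpos i j).le
  refine ⟨∑ i, ∑ j, (k i j : ℝ) / (p ^ k i j) i j,
    Finset.sum_nonneg fun i _ => Finset.sum_nonneg fun j _ => hterm i j, fun b v hb hv => ?_⟩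
  have hiter : ∀ (n : ℕ) i, v i ≤ n * b + ∑ j, (p ^ n) i j * v j := by
    intro n
    induction n with
    | zero => intro i; simp [one_apply]
    | succ n ih =>
      intro i
      have h1 : ∑ j, (p ^ n) i j * v j ≤ ∑ j, (p ^ n) i j * (b + ∑ l, p j l * v l) :=
        Finset.sum_le_sum fun j _ =>
          mul_le_mul_of_nonneg_left (hv j) (pow_apply_nonneg hirr.nonneg n i j)
      have h2 : ∑ j, (p ^ n) i j * (b + ∑ l, p j l * v l)
          = b + ∑ l, (p ^ (n + 1)) i l * v l := by
        simp only [mul_add, Finset.sum_add_distrib]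
        rw [← Finset.sum_mul, sum_row_of_mem_rowStochastic (pow_mem_rowStochastic hp n), one_mul]
        congr 1
        simp only [pow_succ, mul_apply, Finset.sum_mul, Finset.mul_sum]
        rw [Finset.sum_comm]
        exact Finset.sum_congr rfl fun _ _ => Finset.sum_congr rfl fun _ _ => by ring
      have := ih i
      push_cast
      linarith
  -- At a maximum `i₀`, averaging over `k i₀ j` steps falls short of `v i₀` by at least the weight
  -- of `j` times `v i₀ - v j`; this shortfall is at most `k i₀ j * b`.
  obtain ⟨i₀, -, hmax⟩ := Finset.exists_max_image Finset.univ v Finset.univ_nonempty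
  intro i j
  have h1 := hiter (k i₀ j) i₀
  have h2 : ∑ l, (p ^ k i₀ j) i₀ l * v l ≤ v i₀ - (p ^ k i₀ j) i₀ j * (v i₀ - v j) := by
    have : ∑ l, (p ^ k i₀ j) i₀ l * (v i₀ - v l) ≥ (p ^ k i₀ j) i₀ j * (v i₀ - v j) :=
      Finset.single_le_sum (f := fun l => (p ^ k i₀ j) i₀ l * (v i₀ - v l))
        (fun l _ => mul_nonneg (pow_apply_nonneg hirr.nonneg _ _ _)
          (sub_nonneg.2 (hmax l (Finset.mem_univ l)))) (Finset.mem_univ j)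
    simp only [mul_sub, Finset.sum_sub_distrib] at this
    rw [← Finset.sum_mul, sum_row_of_mem_rowStochastic (pow_mem_rowStochastic hp _), one_mul] at this
    linarith
  have h3 : v i₀ - v j ≤ (k i₀ j : ℝ) / (p ^ k i₀ j) i₀ j * b := by
    rw [div_mul_eq_mul_div, le_div_iff₀ (hpos i₀ j)]
    linarith
  have h4 : (k i₀ j : ℝ) / (p ^ k i₀ j) i₀ j ≤ ∑ i, ∑ j, (k i j : ℝ) / (p ^ k i j) i j :=
    (Finset.single_le_sum (f := fun j => (k i₀ j : ℝ) / (p ^ k i₀ j) i₀ j)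
      (fun j _ => hterm i₀ j) (Finset.mem_univ j)).trans
    (Finset.single_le_sum (f := fun i => ∑ j, (k i j : ℝ) / (p ^ k i j) i j)
      (fun i _ => Finset.sum_nonneg fun j _ => hterm i j) (Finset.mem_univ i₀))
  have h5 := mul_le_mul_of_nonneg_right h4 hb
  linarith [hmax i (Finset.mem_univ i)]

end Markov

/-! ### Dual certificates and lower bounds for arbitrary policies -/

section Certificate

variable {Ch : Type*} [Fintype Ch] [DecidableEq Ch]

/-- A potential `Φ` that is bounded above and drifts upwards by at most the mean cost bounds the
expected total cost from below. -/
theorem le_expTotal_of_drift {p : Matrix Ch Ch ℝ} (hp : p ∈ rowStochastic ℝ Ch) {π : Rule Ch}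
    (hπ : IsPolicy π) {c : ℕ → Ch → Bool → ℝ} {Φ : ℕ → Ch → ℝ} {B : ℝ}
    (hB : ∀ x q, Φ x q ≤ B)
    (hdrift : ∀ h x q, 1 ≤ x → Φ x q ≤ π h x q * (c x q true + ∑ q', p q q' * Φ 1 q')
      + (1 - π h x q) * (c x q false + ∑ q', p q q' * Φ (x + 1) q')) (T : ℕ) :
    ∀ h x q, 1 ≤ x → Φ x q - B ≤ expTotal p π c T h x q := by
  induction T with
  | zero => intro h x q _; simpa [expTotal] using hB x q
  | succ T ih =>
    intro h x q hx
    have hstep : ∀ y, 1 ≤ y → ∑ q', p q q' * Φ y q' - B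
        ≤ ∑ q', p q q' * expTotal p π c T ((x, q) :: h) y q' := by
      intro y hy
      have h1 : ∑ q', p q q' * Φ y q' - B = ∑ q', p q q' * (Φ y q' - B) := by
        simp only [mul_sub, Finset.sum_sub_distrib]
        rw [← Finset.sum_mul, sum_row_of_mem_rowStochastic hp, one_mul]
      rw [h1]
      exact Finset.sum_le_sum fun q' _ => mul_le_mul_of_nonneg_left (ih _ _ _ hy)
        (nonneg_of_mem_rowStochastic hp)
    have h0 := hπ h x q
    have h1 := mul_le_mul_of_nonneg_left (hstep 1 le_rfl) h0.1
    have h2 := mul_le_mul_of_nonneg_left (hstep (x + 1) (by omega)) (sub_nonneg.2 h0.2)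
    have h3 := hdrift h x q hx
    rw [expTotal]
    linarith

theorem expTotal_combination {p : Matrix Ch Ch ℝ} (hp : p ∈ rowStochastic ℝ Ch) (π : Rule Ch)
    (c₁ c₂ c₃ : ℕ → Ch → Bool → ℝ) (a b k g : ℝ) (T : ℕ) : ∀ h x q,
    expTotal p π (fun x q s => a * c₁ x q s + b * c₂ x q s - k * c₃ x q s - g) T h x q
      = a * expTotal p π c₁ T h x q + b * expTotal p π c₂ T h x q
        - k * expTotal p π c₃ T h x q - T * g := by
  induction T with
  | zero => intro h x q; simp [expTotal]
  | succ T ih =>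
    intro h x q
    have hs : ∀ f₁ f₂ f₃ : Ch → ℝ, ∑ q', p q q' * (a * f₁ q' + b * f₂ q' - k * f₃ q' - T * g)
        = a * ∑ q', p q q' * f₁ q' + b * ∑ q', p q q' * f₂ q' - k * ∑ q', p q q' * f₃ q'
          - T * g := by
      intro f₁ f₂ f₃
      have h1 : (T : ℝ) * g = ∑ q', p q q' * (T * g) := by
        rw [← Finset.sum_mul, sum_row_of_mem_rowStochastic hp, one_mul]
      conv_rhs => rw [h1]
      simp only [Finset.mul_sum, ← Finset.sum_add_distrib, ← Finset.sum_sub_distrib]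
      exact Finset.sum_congr rfl fun _ _ => by ring
    simp only [expTotal, ih, hs]
    push_cast
    ring

theorem expAverage_combination {p : Matrix Ch Ch ℝ} (hp : p ∈ rowStochastic ℝ Ch) (π : Rule Ch)
    {ν : Ch → ℝ} (hν : ν ∈ stdSimplex ℝ Ch)
    (c₁ c₂ c₃ : ℕ → Ch → Bool → ℝ) (a b k g : ℝ) {T : ℕ} (hT : 0 < T) :
    expAverage p ν π (fun x q s => a * c₁ x q s + b * c₂ x q s - k * c₃ x q s - g) T
      = a * expAverage p ν π c₁ T + b * expAverage p ν π c₂ T - k * expAverage p ν π c₃ T - g := by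
  have hT' : (T : ℝ) ≠ 0 := by positivity
  have h1 : ∀ f₁ f₂ f₃ : Ch → ℝ, ∑ q', ν q' * (a * f₁ q' + b * f₂ q' - k * f₃ q' - T * g)
      = a * ∑ q', ν q' * f₁ q' + b * ∑ q', ν q' * f₂ q' - k * ∑ q', ν q' * f₃ q' - T * g := by
    intro f₁ f₂ f₃
    have h1 : (T : ℝ) * g = ∑ q', ν q' * (T * g) := by
      rw [← Finset.sum_mul, hν.2, one_mul]
    conv_rhs => rw [h1]
    simp only [Finset.mul_sum, ← Finset.sum_add_distrib, ← Finset.sum_sub_distrib]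
    exact Finset.sum_congr rfl fun _ _ => by ring
  simp only [expAverage, expTotal_combination hp, h1]
  field_simp

/-- A dual certificate for the power constrained problem: a solution `Φ` of the optimality
inequalities of the problem with mean cost `g` and price `l` for power, that increases in the age
with slope at least one and grows at most linearly. -/
structure IsCertificate (p : Matrix Ch Ch ℝ) (ω : Ch → ℝ) (W g l : ℝ) (Φ : ℕ → Ch → ℝ) :
    Prop where
  price_nonneg : 0 ≤ l
  transmit : ∀ x q, 1 ≤ x → Φ x q ≤ x + W + l * ω q - g + ∑ q', p q q' * Φ 1 q'
  wait : ∀ x q, 1 ≤ x → Φ x q ≤ x - g + ∑ q', p q q' * Φ (x + 1) q'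
  slope : ∀ x q, 1 ≤ x → Φ x q + 1 ≤ Φ (x + 1) q
  growth : ∃ B : ℝ, ∀ x q, Φ x q ≤ x + B

/-- The loss caused by a transmission. -/
def transmitLoss (p : Matrix Ch Ch ℝ) (ω : Ch → ℝ) (W g l : ℝ) (Φ : ℕ → Ch → ℝ) (x : ℕ) (q : Ch) :
    ℝ := x + W + l * ω q - g + ∑ q', p q q' * Φ 1 q' - Φ x q

/-- The loss caused by waiting. -/
def waitLoss (p : Matrix Ch Ch ℝ) (g : ℝ) (Φ : ℕ → Ch → ℝ) (x : ℕ) (q : Ch) : ℝ :=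
  x - g + ∑ q', p q q' * Φ (x + 1) q' - Φ x q

variable {p : Matrix Ch Ch ℝ} {ω : Ch → ℝ} {W g l E : ℝ} {Φ : ℕ → Ch → ℝ}

omit [DecidableEq Ch] in
theorem IsCertificate.transmitLoss_nonneg (hc : IsCertificate p ω W g l Φ) {x : ℕ} (hx : 1 ≤ x)
    (q : Ch) : 0 ≤ transmitLoss p ω W g l Φ x q := sub_nonneg.2 (hc.transmit x q hx)

omit [DecidableEq Ch] in
theorem IsCertificate.waitLoss_nonneg (hc : IsCertificate p ω W g l Φ) {x : ℕ} (hx : 1 ≤ x)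
    (q : Ch) : 0 ≤ waitLoss p g Φ x q := sub_nonneg.2 (hc.wait x q hx)

/-- The advantage of a transmission over waiting increases strictly with the age. -/
theorem IsCertificate.loss_strictAnti (hp : p ∈ rowStochastic ℝ Ch)
    (hc : IsCertificate p ω W g l Φ) (q : Ch) {x y : ℕ} (hx : 1 ≤ x) (hxy : x < y) :
    transmitLoss p ω W g l Φ y q - waitLoss p g Φ y q
      < transmitLoss p ω W g l Φ x q - waitLoss p g Φ x q := by
  induction y, hxy using Nat.le_induction with
  | base =>
    have : ∑ q', p q q' * (Φ (x + 1) q' + 1) ≤ ∑ q', p q q' * Φ (x + 1 + 1) q' :=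
      Finset.sum_le_sum fun q' _ => mul_le_mul_of_nonneg_left (hc.slope _ _ (by omega))
        (nonneg_of_mem_rowStochastic hp)
    simp only [mul_add, Finset.sum_add_distrib, mul_one, sum_row_of_mem_rowStochastic hp] at this
    simp only [transmitLoss, waitLoss, Nat.succ_eq_add_one]
    push_cast
    linarith
  | succ y hxy ih =>
    have : ∑ q', p q q' * (Φ (y + 1) q' + 1) ≤ ∑ q', p q q' * Φ (y + 1 + 1) q' :=
      Finset.sum_le_sum fun q' _ => mul_le_mul_of_nonneg_left (hc.slope _ _ (by omega))
        (nonneg_of_mem_rowStochastic hp)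
    simp only [mul_add, Finset.sum_add_distrib, mul_one, sum_row_of_mem_rowStochastic hp] at this
    refine lt_trans ?_ ih
    simp only [transmitLoss, waitLoss]
    push_cast
    linarith

/-- `Φ` grows at most linearly, so subtracting `ε x (x - 1) / 2` bounds it above. The quadratic
gains `ε x` under waiting, paid by the factor `1 + ε` on the age cost, and resets to zero on
transmission. The loss `k` is charged at each visit to `(x₀, q₀)`. -/
theorem IsCertificate.average_bound (hp : p ∈ rowStochastic ℝ Ch)
    (hc : IsCertificate p ω W g l Φ) (hW : 0 ≤ W) {ν : Ch → ℝ} (hν : ν ∈ stdSimplex ℝ Ch)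
    {π : Rule Ch} (hπ : IsPolicy π) (x₀ : ℕ) (q₀ : Ch) {k : ℝ}
    (hk : ∀ h, k ≤ π h x₀ q₀ * transmitLoss p ω W g l Φ x₀ q₀
      + (1 - π h x₀ q₀) * waitLoss p g Φ x₀ q₀) {ε : ℝ} (hε : 0 < ε) :
    ∃ B : ℝ, ∀ T : ℕ, 0 < T → g + k * expAverage p ν π (visit x₀ q₀) T
      ≤ (1 + ε) * expAverage p ν π (ageCost W) T + l * expAverage p ν π (powerCost ω) T
        + B / T := by
  obtain ⟨B, hB⟩ := hc.growth
  set Ψ : ℕ → Ch → ℝ := fun x q => Φ x q - ε * (x * (x - 1) / 2) with hΨ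
  -- The maximum of the concave parabola that dominates `Ψ`.
  set B₁ : ℝ := B + (1 + ε / 2) ^ 2 / (2 * ε) with hB₁
  have hΨB : ∀ x q, Ψ x q ≤ B₁ := by
    intro x q
    have h1 := hB x q
    have h2 : (x : ℝ) * (1 + ε / 2) - ε * x ^ 2 / 2 ≤ (1 + ε / 2) ^ 2 / (2 * ε) := by
      rw [le_div_iff₀ (by positivity)]
      nlinarith [sq_nonneg (ε * x - (1 + ε / 2))]
    simp only [hΨ, hB₁]
    nlinarith
  have hdrift := le_expTotal_of_drift hp hπ
    (c := fun x q s => (1 + ε) * ageCost W x q s + l * powerCost ω x q s - k * visit x₀ q₀ x q s - g)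
    hΨB (by
    intro h x q hx
    have hx' : (1 : ℝ) ≤ x := by exact_mod_cast hx
    have h1 : ∑ q', p q q' * Ψ 1 q' = ∑ q', p q q' * Φ 1 q' := by
      simp [hΨ]
    have h2 : ∑ q', p q q' * Ψ (x + 1) q'
        = ∑ q', p q q' * Φ (x + 1) q' - ε * ((x + 1) * x / 2) := by
      simp only [hΨ, mul_sub, Finset.sum_sub_distrib]
      rw [← Finset.sum_mul, sum_row_of_mem_rowStochastic hp]
      push_cast
      ring
    have hA₁ := hc.transmitLoss_nonneg hx q
    have hA₀ := hc.waitLoss_nonneg hx q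
    obtain ⟨hπ0, hπ1⟩ := hπ h x q
    have hloss : k * (if x = x₀ ∧ q = q₀ then 1 else 0) ≤ π h x q * transmitLoss p ω W g l Φ x q
        + (1 - π h x q) * waitLoss p g Φ x q := by
      split_ifs with hxq
      · obtain ⟨rfl, rfl⟩ := hxq
        simpa using hk h
      · have := mul_nonneg hπ0 hA₁
        have := mul_nonneg (sub_nonneg.2 hπ1) hA₀
        linarith
    have h3 : 0 ≤ π h x q * (ε * (x + W) + ε * (x * (x - 1) / 2)) := by
      have : (0 : ℝ) ≤ x - 1 := by linarith
      positivity
    rw [h1, h2]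
    simp only [ageCost, powerCost, visit, hΨ, if_true, Bool.false_eq_true, if_false]
    simp only [transmitLoss, waitLoss] at hloss
    generalize (if x = x₀ ∧ q = q₀ then (1 : ℝ) else 0) = v at *
    nlinarith)
  refine ⟨-∑ q, ν q * (Ψ 1 q - B₁), fun T hT => ?_⟩
  have h1 := expAverage_combination hp π hν (ageCost W) (powerCost ω) (visit x₀ q₀) (1 + ε) l k g hT
  have h2 : (∑ q, ν q * (Ψ 1 q - B₁)) / T ≤ expAverage p ν π (fun x q s => (1 + ε) * ageCost W x q s
      + l * powerCost ω x q s - k * visit x₀ q₀ x q s - g) T :=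
    div_le_div_of_nonneg_right (Finset.sum_le_sum fun q _ =>
      mul_le_mul_of_nonneg_left (hdrift T [] 1 q le_rfl) (hν.1 q)) (Nat.cast_nonneg _)
  rw [h1] at h2
  rw [neg_div]
  linarith

omit [DecidableEq Ch] in
theorem eventually_expAverage_lt {ν : Ch → ℝ} {π : Rule Ch} {c : ℕ → Ch → Bool → ℝ} {a b : ℝ}
    (h : longRun p ν π c ≤ (a : EReal)) (hab : a < b) :
    ∀ᶠ T in atTop, expAverage p ν π c T < b := by
  have h1 : longRun p ν π c < (b : EReal) := h.trans_lt (EReal.coe_lt_coe_iff.2 hab)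
  exact (eventually_lt_of_limsup_lt h1).mono fun T hT => EReal.coe_lt_coe_iff.1 hT

/-- The mean loss is at most the gap between the mean cost and the certified value. -/
theorem IsCertificate.loss_le (hp : p ∈ rowStochastic ℝ Ch)
    (hc : IsCertificate p ω W g l Φ) (hW : 0 ≤ W) {ν : Ch → ℝ} (hν : ν ∈ stdSimplex ℝ Ch)
    {π : Rule Ch} (hπ : IsFeasible p ω E ν π) {x₀ : ℕ} {q₀ : Ch} {k : ℝ}
    (hk : ∀ h, k ≤ π h x₀ q₀ * transmitLoss p ω W g l Φ x₀ q₀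
      + (1 - π h x₀ q₀) * waitLoss p g Φ x₀ q₀) {C s : ℝ}
    (hC : longRun p ν π (ageCost W) ≤ (C : EReal))
    (hs : ∃ᶠ T in atTop, s ≤ k * expAverage p ν π (visit x₀ q₀) T) : s + (g - l * E) ≤ C := by
  by_contra hlt
  push Not at hlt
  have hl := hc.price_nonneg
  -- `η * D` absorbs the errors `η * C`, `η * η`, `l * η` and twice `η` that arise with `ε = η`.
  set D : ℝ := |C| + l + 4 with hD
  have hD0 : 0 < D := by have := abs_nonneg C; linarith
  obtain ⟨η, hη0, hη1, hη⟩ : ∃ η : ℝ, 0 < η ∧ η ≤ 1 ∧ η * D < s + (g - l * E) - C := by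
    refine ⟨min 1 ((s + (g - l * E) - C) / (2 * D)), lt_min one_pos (by
      apply div_pos <;> linarith), min_le_left _ _, ?_⟩
    have h1 := mul_le_mul_of_nonneg_right
      (min_le_right 1 ((s + (g - l * E) - C) / (2 * D))) hD0.le
    have h2 : (s + (g - l * E) - C) / (2 * D) * D = (s + (g - l * E) - C) / 2 := by
      field_simp
    linarith
  obtain ⟨B, hB⟩ := hc.average_bound hp hW hν hπ.policy x₀ q₀ hk hη0
  have hBT : ∀ᶠ T : ℕ in atTop, B / T < η :=
    (tendsto_const_div_atTop_nhds_zero_nat B).eventually_lt_const hη0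
  obtain ⟨T, hsT, ⟨⟨hcost, hpow⟩, hBT⟩, hT⟩ := (hs.and_eventually
    ((((eventually_expAverage_lt hC (lt_add_of_pos_right C hη0)).and
      (eventually_expAverage_lt hπ.power (lt_add_of_pos_right E hη0))).and hBT).and
        (eventually_gt_atTop 0))).exists
  have h1 := hB T hT
  have h2 := mul_le_mul_of_nonneg_left hcost.le (by linarith : 0 ≤ 1 + η)
  have h3 := mul_le_mul_of_nonneg_left hpow.le hl
  have h4 : η * C ≤ η * |C| := mul_le_mul_of_nonneg_left (le_abs_self C) hη0.le
  have h5 : η * η ≤ η := mul_le_of_le_one_left hη0.le hη1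
  simp only [hD] at hη
  linarith

/-- Weak duality: this is the loss bound with nothing charged, `k = 0`. -/
theorem IsCertificate.le_longRun (hp : p ∈ rowStochastic ℝ Ch) [Nonempty Ch]
    (hc : IsCertificate p ω W g l Φ) (hW : 0 ≤ W) {ν : Ch → ℝ} (hν : ν ∈ stdSimplex ℝ Ch)
    {π : Rule Ch} (hπ : IsFeasible p ω E ν π) :
    ((g - l * E : ℝ) : EReal) ≤ longRun p ν π (ageCost W) := by
  obtain ⟨q⟩ := ‹Nonempty Ch›
  by_contra hlt
  push Not at hlt
  obtain ⟨C, hC, hC'⟩ := EReal.lt_iff_exists_real_btwn.1 hlt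
  have := hc.loss_le hp hW hν hπ (x₀ := 1) (q₀ := q) (k := 0) (s := 0) (fun h =>
    add_nonneg (mul_nonneg (hπ.policy h 1 q).1 (hc.transmitLoss_nonneg le_rfl q))
      (mul_nonneg (sub_nonneg.2 (hπ.policy h 1 q).2) (hc.waitLoss_nonneg le_rfl q))) hC.le
    (Eventually.of_forall fun T => by simp).frequently
  have h2 := EReal.coe_lt_coe_iff.1 hC'
  linarith

/-- A stationary policy that attains the certified value incurs no loss in the states that it
visits with positive frequency. -/
theorem IsCertificate.loss_eq_zero (hp : p ∈ rowStochastic ℝ Ch)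
    (hc : IsCertificate p ω W g l Φ) (hW : 0 ≤ W) {ν : Ch → ℝ} (hν : ν ∈ stdSimplex ℝ Ch)
    {ξ : ℕ → Ch → ℝ} (hξ : IsFeasible p ω E ν (stationary ξ))
    (hopt : longRun p ν (stationary ξ) (ageCost W) ≤ ((g - l * E : ℝ) : EReal)) {x : ℕ} {q : Ch}
    (hx : 1 ≤ x) (hvisit : 0 < longRun p ν (stationary ξ) (visit x q)) :
    ξ x q * transmitLoss p ω W g l Φ x q = 0 ∧ (1 - ξ x q) * waitLoss p g Φ x q = 0 := by
  have h1 := mul_nonneg (hξ.policy [] x q).1 (hc.transmitLoss_nonneg hx q)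
  have h2 := mul_nonneg (sub_nonneg.2 (hξ.policy [] x q).2) (hc.waitLoss_nonneg hx q)
  simp only [stationary] at h1 h2
  obtain ⟨δ, hδ, hδ'⟩ := EReal.lt_iff_exists_real_btwn.1 hvisit
  have hδ0 : 0 < δ := EReal.coe_lt_coe_iff.1 hδ
  set k := ξ x q * transmitLoss p ω W g l Φ x q + (1 - ξ x q) * waitLoss p g Φ x q with hk
  -- The visit frequency exceeds `δ` only infinitely often; this suffices because the other
  -- estimates hold eventually.
  have h3 := hc.loss_le hp hW hν hξ (x₀ := x) (q₀ := q) (k := k) (s := k * δ)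
    (fun h => le_rfl) hopt
    ((frequently_lt_of_lt_limsup (by isBoundedDefault) hδ').mono fun T hT =>
      mul_le_mul_of_nonneg_left (EReal.coe_lt_coe_iff.1 hT).le (by linarith))
  have h4 : k ≤ 0 := by
    by_contra h
    push Not at h
    have := mul_pos h hδ0
    linarith
  constructor <;> linarith

end Certificate

/-! ### The chain on the ages up to `n + 1` -/

section Truncated

variable {Ch : Type*} [Fintype Ch] [DecidableEq Ch] {p : Matrix Ch Ch ℝ} {n : ℕ}

theorem sum_ite_val_eq (f : Fin (n + 1) → ℝ) (y : ℕ) :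
    ∑ j : Fin (n + 1), (if j.val = y then f j else 0) = if h : y < n + 1 then f ⟨y, h⟩ else 0 := by
  split_ifs with h
  · rw [Finset.sum_eq_single ⟨y, h⟩]
    · simp
    · intro j _ hj
      exact if_neg fun hjy => hj (Fin.ext hjy)
    · simp
  · exact Finset.sum_eq_zero fun j _ => if_neg fun hj : j.val = y => h (hj ▸ j.2)

/-- Transition matrix of the stationary policy `ξ`, restricted to the ages `1, …, n + 1`. -/
def ageMatrix (p : Matrix Ch Ch ℝ) (ξ : ℕ → Ch → ℝ) (n : ℕ) :
    Matrix (Fin (n + 1) × Ch) (Fin (n + 1) × Ch) ℝ := fun a b =>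
  p a.2 b.2 * (ξ (a.1 + 1) a.2 * (if b.1.val = 0 then 1 else 0)
    + (1 - ξ (a.1 + 1) a.2) * (if b.1.val = a.1.val + 1 then 1 else 0))

omit [DecidableEq Ch] in
theorem ageMatrix_mulVec {ξ : ℕ → Ch → ℝ} (hlast : ∀ q, ξ (n + 1) q = 1) (F : ℕ → Ch → ℝ)
    (a : Fin (n + 1) × Ch) :
    (ageMatrix p ξ n *ᵥ fun b => F (b.1 + 1) b.2) a
      = ξ (a.1 + 1) a.2 * ∑ r, p a.2 r * F 1 r
        + (1 - ξ (a.1 + 1) a.2) * ∑ r, p a.2 r * F (a.1 + 1 + 1) r := by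
  obtain ⟨i, q⟩ := a
  simp only [mulVec, dotProduct, ageMatrix, Fintype.sum_prod_type]
  rw [Finset.sum_comm]
  have h1 : ∀ r, ∑ j : Fin (n + 1), p q r * (ξ (i + 1) q * (if j.val = 0 then 1 else 0)
      + (1 - ξ (i + 1) q) * (if j.val = i.val + 1 then 1 else 0)) * F (j + 1) r
      = ξ (i + 1) q * (p q r * F 1 r) + (1 - ξ (i + 1) q) * (p q r * F (i + 1 + 1) r) := by
    intro r
    have h2 : ∀ j : Fin (n + 1), p q r * (ξ (i + 1) q * (if j.val = 0 then 1 else 0)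
      + (1 - ξ (i + 1) q) * (if j.val = i.val + 1 then 1 else 0)) * F (j + 1) r
      = (if j.val = 0 then p q r * ξ (i + 1) q * F (j + 1) r else 0)
        + (if j.val = i.val + 1 then p q r * (1 - ξ (i + 1) q) * F (j + 1) r else 0) := by
      intro j
      split_ifs <;> ring
    rw [Finset.sum_congr rfl fun j _ => h2 j, Finset.sum_add_distrib,
      sum_ite_val_eq (fun j => p q r * ξ (i + 1) q * F (j + 1) r),
      sum_ite_val_eq (fun j => p q r * (1 - ξ (i + 1) q) * F (j + 1) r), dif_pos (Nat.succ_pos n)]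
    split_ifs with h
    · simp only [zero_add]
      ring
    -- At the age `n + 1` the successor under waiting is missing, but `hlast` gives it weight zero.
    · have : i.val = n := by omega
      simp only [this, hlast, zero_add]
      ring
  rw [Finset.sum_congr rfl fun r _ => h1 r, Finset.sum_add_distrib, Finset.mul_sum, Finset.mul_sum]

theorem ageMatrix_mem_rowStochastic (hp : p ∈ rowStochastic ℝ Ch) {ξ : ℕ → Ch → ℝ}
    (hξ : IsStationaryPolicy ξ) (hlast : ∀ q, ξ (n + 1) q = 1) :
    ageMatrix p ξ n ∈ rowStochastic ℝ (Fin (n + 1) × Ch) := by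
  refine ⟨fun a b => ?_, ?_⟩
  · have h0 := (hξ (a.1 + 1) a.2).1
    have h1 := sub_nonneg.2 (hξ (a.1 + 1) a.2).2
    have h2 : 0 ≤ p a.2 b.2 := nonneg_of_mem_rowStochastic hp
    unfold ageMatrix
    split_ifs <;> positivity
  · funext a
    have := ageMatrix_mulVec (p := p) hlast (fun _ _ => (1 : ℝ)) a
    simp only [mul_one, sum_row_of_mem_rowStochastic hp, add_sub_cancel] at this
    exact this

omit [DecidableEq Ch] in
theorem vecMul_ageMatrix_zero (m : Fin (n + 1) × Ch → ℝ) (ξ : ℕ → Ch → ℝ) (r : Ch) :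
    (m ᵥ* ageMatrix p ξ n) (0, r) = ∑ a, m a * ξ (a.1 + 1) a.2 * p a.2 r := by
  simp only [vecMul, dotProduct, ageMatrix]
  refine Finset.sum_congr rfl fun a _ => ?_
  simp
  ring

omit [DecidableEq Ch] in
theorem vecMul_ageMatrix_succ (m : Fin (n + 1) × Ch → ℝ) (ξ : ℕ → Ch → ℝ) {y : ℕ}
    (hy : y + 1 < n + 1) (r : Ch) :
    (m ᵥ* ageMatrix p ξ n) (⟨y + 1, hy⟩, r)
      = ∑ q, m (⟨y, by omega⟩, q) * (1 - ξ (y + 1) q) * p q r := by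
  simp only [vecMul, dotProduct, ageMatrix, Fintype.sum_prod_type]
  rw [Finset.sum_comm]
  refine Finset.sum_congr rfl fun q _ => ?_
  have := sum_ite_val_eq (n := n) (fun i => m (i, q) * (1 - ξ (i + 1) q) * p q r) y
  rw [dif_pos (by omega)] at this
  rw [← this]
  refine Finset.sum_congr rfl fun i _ => ?_
  by_cases h : i.val = y
  · simp [h]; ring
  · simp [h, Ne.symm h]

/-- Extension by zero of a function of the ages `1, …, n + 1`. -/
def extend (m : Fin (n + 1) × Ch → ℝ) (x : ℕ) (q : Ch) : ℝ :=
  if h : 1 ≤ x ∧ x ≤ n + 1 then m (⟨x - 1, by omega⟩, q) else 0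

omit [Fintype Ch] [DecidableEq Ch] in
@[simp] theorem extend_succ (m : Fin (n + 1) × Ch → ℝ) (i : Fin (n + 1)) (q : Ch) :
    extend m (i + 1) q = m (i, q) := by
  have := i.2
  simp [extend, Nat.le_of_lt_succ this]

omit [Fintype Ch] [DecidableEq Ch] in
theorem extend_of_lt (m : Fin (n + 1) × Ch → ℝ) {x : ℕ} (hx : n + 1 < x) (q : Ch) :
    extend m x q = 0 := dif_neg (by omega)

omit [DecidableEq Ch] in
/-- Sum of a function supported on the ages `1, …, n + 1`. -/
theorem hasSum_of_support {F : ℕ × Ch → ℝ}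
    (hF : ∀ x q, ¬(1 ≤ x ∧ x ≤ n + 1) → F (x, q) = 0) :
    HasSum F (∑ a : Fin (n + 1) × Ch, F (a.1 + 1, a.2)) := by
  let e : Fin (n + 1) × Ch → ℕ × Ch := fun a => (a.1 + 1, a.2)
  have he : Function.Injective e := by
    rintro ⟨i, q⟩ ⟨j, r⟩ h
    simp only [e, Prod.mk.injEq, add_left_inj] at h
    exact Prod.ext (Fin.ext h.1) h.2
  refine (he.hasSum_iff ?_).1 (hasSum_fintype (F ∘ e))
  rintro ⟨x, q⟩ hx
  refine hF x q fun h => hx ⟨(⟨x - 1, by omega⟩, q), ?_⟩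
  simp only [e, Prod.mk.injEq, and_true]
  omega

omit [DecidableEq Ch] in
-- The age `n + 1` always transmits, so no mass leaves the truncated range and balance on the finite
-- chain is balance on all ages.
theorem isSteadyState_extend {ξ : ℕ → Ch → ℝ} (hlast : ∀ q, ξ (n + 1) q = 1)
    {m : Fin (n + 1) × Ch → ℝ} (hm : m ∈ stdSimplex ℝ (Fin (n + 1) × Ch))
    (hmM : m ᵥ* ageMatrix p ξ n = m) : IsSteadyState p ξ (extend m) where
  nonneg x q := by
    unfold extend
    split_ifs
    exacts [hm.1 _, le_rfl]
  age_zero q := dif_neg (by omega)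
  total := by
    have := hasSum_of_support (n := n) (F := fun s : ℕ × Ch => extend m s.1 s.2)
      (fun x q h => dif_neg h)
    simpa [hm.2] using this
  reset r := by
    have := hasSum_of_support (n := n)
      (F := fun s : ℕ × Ch => extend m s.1 s.2 * ξ s.1 s.2 * p s.2 r)
      (fun x q h => by simp [extend, dif_neg h])
    convert this using 1
    have h0 := extend_succ m 0 r
    have h1 := congrFun hmM (0, r)
    rw [vecMul_ageMatrix_zero] at h1
    simp only [Fin.val_zero, zero_add] at h0
    rw [h0, ← h1]
    simp
  step x hx r := by
    obtain ⟨y, rfl⟩ := Nat.exists_eq_add_of_le' hx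
    rcases lt_trichotomy y n with hy | rfl | hy
    · have h1 := congrFun hmM (⟨y + 1, by omega⟩, r)
      rw [vecMul_ageMatrix_succ] at h1
      have h2 := extend_succ m ⟨y + 1, by omega⟩ r
      have h3 := fun q => extend_succ m ⟨y, by omega⟩ q
      simp only at h2 h3
      rw [h2, ← h1]
      simp only [h3]
    · simp [hlast, extend_of_lt m (show y + 1 < y + 1 + 1 by omega)]
    · simp [extend_of_lt m (show n + 1 < y + 1 by omega),
        extend_of_lt m (show n + 1 < y + 1 + 1 by omega)]

/-- Mean one-step cost of the stationary policy `ξ`. -/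
def meanCost (ξ : ℕ → Ch → ℝ) (c : ℕ → Ch → Bool → ℝ) (x : ℕ) (q : Ch) : ℝ :=
  ξ x q * c x q true + (1 - ξ x q) * c x q false

theorem expTotal_stationary {ξ : ℕ → Ch → ℝ} (hlast : ∀ q, ξ (n + 1) q = 1)
    (c : ℕ → Ch → Bool → ℝ) (T : ℕ) : ∀ (h : List (ℕ × Ch)) (a : Fin (n + 1) × Ch),
    expTotal p (stationary ξ) c T h (a.1 + 1) a.2
      = ∑ t ∈ Finset.range T,
        (ageMatrix p ξ n ^ t *ᵥ fun b => meanCost ξ c (b.1 + 1) b.2) a := by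
  induction T with
  | zero => intro h a; simp [expTotal]
  | succ T ih =>
    intro h a
    set f : Fin (n + 1) × Ch → ℝ := fun b => meanCost ξ c (b.1 + 1) b.2
    have hf : ∀ h', (fun b : Fin (n + 1) × Ch => expTotal p (stationary ξ) c T h' (b.1 + 1) b.2)
        = ∑ t ∈ Finset.range T, ageMatrix p ξ n ^ t *ᵥ f := by
      intro h'
      funext b
      rw [ih h' b, Finset.sum_apply]
    have h1 := ageMatrix_mulVec (p := p) hlast
      (fun x q => expTotal p (stationary ξ) c T ((a.1.val + 1, a.2) :: h) x q) a
    rw [hf, Matrix.mulVec_sum, Finset.sum_apply] at h1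
    rw [Finset.sum_range_succ', Finset.sum_congr rfl fun t _ => by
      rw [pow_succ', ← mulVec_mulVec], h1]
    simp only [expTotal, stationary, pow_zero, one_mulVec, f, meanCost]
    ring

/-- Under a stationary policy that always transmits at the age `n + 1`, and whose chain has a
unique stationary distribution, time averages converge to stationary means. -/
theorem tendsto_expAverage (hp : p ∈ rowStochastic ℝ Ch) {ξ : ℕ → Ch → ℝ}
    (hξ : IsStationaryPolicy ξ) (hlast : ∀ q, ξ (n + 1) q = 1) {m : Fin (n + 1) × Ch → ℝ}
    (huniq : ∀ m' ∈ stdSimplex ℝ (Fin (n + 1) × Ch), m' ᵥ* ageMatrix p ξ n = m' → m' = m)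
    {ν : Ch → ℝ} (hν : ν ∈ stdSimplex ℝ Ch) (c : ℕ → Ch → Bool → ℝ) :
    Tendsto (expAverage p ν (stationary ξ) c) atTop
      (𝓝 (∑ a, m a * meanCost ξ c (a.1 + 1) a.2)) := by
  set v : Fin (n + 1) × Ch → ℝ := fun a => if a.1 = 0 then ν a.2 else 0 with hv
  have hvmem : v ∈ stdSimplex ℝ (Fin (n + 1) × Ch) := by
    refine ⟨fun a => ?_, ?_⟩
    · simp only [hv]
      split_ifs
      exacts [hν.1 _, le_rfl]
    · rw [Fintype.sum_prod_type, Finset.sum_comm]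
      simpa [hv] using hν.2
  have hlim := tendsto_cesaro (ageMatrix_mem_rowStochastic hp hξ hlast) hvmem huniq
  set f : Fin (n + 1) × Ch → ℝ := fun b => meanCost ξ c (b.1 + 1) b.2 with hf
  have heq : expAverage p ν (stationary ξ) c
      = fun T => cesaro (ageMatrix p ξ n) v T ⬝ᵥ f := by
    funext T
    have h1 : ∀ q, expTotal p (stationary ξ) c T [] 1 q
        = ∑ t ∈ Finset.range T, (ageMatrix p ξ n ^ t *ᵥ f) (0, q) := fun q =>
      expTotal_stationary hlast c T [] (0, q)
    have h2 : ∀ w : Fin (n + 1) × Ch → ℝ, v ⬝ᵥ w = ∑ q, ν q * w (0, q) := by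
      intro w
      simp only [dotProduct, Fintype.sum_prod_type]
      rw [Finset.sum_comm]
      simp [hv]
    simp only [expAverage, h1, cesaro]
    rw [smul_dotProduct, sum_dotProduct, smul_eq_mul, div_eq_inv_mul]
    congr 1
    have h3 : ∀ t, v ᵥ* ageMatrix p ξ n ^ t ⬝ᵥ f
        = ∑ q, ν q * (ageMatrix p ξ n ^ t *ᵥ f) (0, q) := fun t => by
      rw [← dotProduct_mulVec, h2]
    simp only [h3, Finset.mul_sum]
    exact Finset.sum_comm
  rw [heq]
  have hcont : Continuous fun w : Fin (n + 1) × Ch → ℝ => w ⬝ᵥ f := by fun_prop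
  exact (hcont.tendsto m).comp hlim

/-- If every scheduling probability is positive then the stationary distribution is unique. -/
theorem stationary_unique_of_pos [Nonempty Ch] (hp : p ∈ rowStochastic ℝ Ch)
    (hirr : p.IsIrreducible) {ξ : ℕ → Ch → ℝ}
    (hξ : IsStationaryPolicy ξ) (hlast : ∀ q, ξ (n + 1) q = 1) (hpos : ∀ x q, 1 ≤ x → 0 < ξ x q)
    {m m' : Fin (n + 1) × Ch → ℝ} (hm : m ∈ stdSimplex ℝ (Fin (n + 1) × Ch))
    (hm' : m' ∈ stdSimplex ℝ (Fin (n + 1) × Ch))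
    (hmM : m ᵥ* ageMatrix p ξ n = m) (hmM' : m' ᵥ* ageMatrix p ξ n = m') : m' = m := by
  obtain ⟨q₀⟩ := ‹Nonempty Ch›
  refine stationary_unique (ageMatrix_mem_rowStochastic hp hξ hlast) (0, q₀) ?_ hm hm' hmM hmM'
  rintro ρ hρ hρM ⟨⟨i, q⟩, hiq⟩
  -- Each charged state feeds age one with every possible next channel state. Irreducibility then
  -- spreads the charge over all channel states at age one.
  have hstep : ∀ (i : Fin (n + 1)) (q r : Ch), 0 < ρ (i, q) → 0 < p q r → 0 < ρ (0, r) := by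
    intro i q r hiq hqr
    have h1 := congrFun hρM (0, r)
    rw [vecMul_ageMatrix_zero] at h1
    rw [← h1]
    refine Finset.sum_pos' (fun a _ => ?_) ⟨(i, q), Finset.mem_univ _, ?_⟩
    · exact mul_nonneg (mul_nonneg (hρ a) (hξ _ _).1) (hirr.nonneg _ _)
    · exact mul_pos (mul_pos hiq (hpos _ _ (by simp))) hqr
  have hrow : ∃ r, 0 < p q r := by
    by_contra h
    push Not at h
    have h1 : ∑ r, p q r ≤ 0 := Finset.sum_nonpos fun r _ => h r
    linarith [sum_row_of_mem_rowStochastic hp q]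
  obtain ⟨r, hr⟩ := hrow
  exact pos_of_isIrreducible hirr (P := fun r => 0 < ρ (0, r)) (fun i j hi hij => hstep 0 i j hi hij)
    (hstep i q r hiq hr) q₀

/-! ### State-action frequencies -/

/-- Constraint matrix of the linear program over state-action frequencies for the ages
`1, …, n + 1`: inflow minus outflow. Waiting at the age `n + 1` removes mass. -/
def flow (p : Matrix Ch Ch ℝ) (n : ℕ) (i : Fin (n + 1) × Ch × Bool) (k : Fin (n + 1) × Ch) : ℝ :=
  p i.2.1 k.2 * (if k.1.val = (if i.2.2 then 0 else i.1.val + 1) then 1 else 0)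
    - if k = (i.1, i.2.1) then 1 else 0

/-- The dual reading of `flow`: the expected increment of a potential in one transition, with value
zero after waiting at the age `n + 1`. -/
theorem sum_mul_flow (V : Fin (n + 1) × Ch → ℝ) (i : Fin (n + 1)) (q : Ch) (s : Bool) :
    ∑ k, V k * flow p n (i, q, s) k
      = (if h : (if s then 0 else i.val + 1) < n + 1 then
          ∑ r, p q r * V (⟨if s then 0 else i.val + 1, h⟩, r) else 0) - V (i, q) := by
  simp only [flow, mul_sub, Finset.sum_sub_distrib]
  congr 1
  · rw [Fintype.sum_prod_type, Finset.sum_comm]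
    have : ∀ r, ∑ j : Fin (n + 1), V (j, r) * (p q r *
        (if j.val = (if s then 0 else i.val + 1) then 1 else 0))
        = if h : (if s then 0 else i.val + 1) < n + 1 then
          p q r * V (⟨if s then 0 else i.val + 1, h⟩, r) else 0 := by
      intro r
      rw [← sum_ite_val_eq (fun j => p q r * V (j, r))]
      refine Finset.sum_congr rfl fun j _ => ?_
      split_ifs <;> ring
    rw [Finset.sum_congr rfl fun r _ => this r]
    split_ifs <;> simp
  · simp

omit [DecidableEq Ch] in
theorem sum_actions (f : Fin (n + 1) × Ch × Bool → ℝ) :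
    ∑ i, f i = ∑ a : Fin (n + 1) × Ch, (f (a.1, a.2, true) + f (a.1, a.2, false)) := by
  simp only [Fintype.sum_prod_type, Fintype.sum_bool]

/-- State frequencies of state-action frequencies. -/
def mass (z : Fin (n + 1) × Ch × Bool → ℝ) (a : Fin (n + 1) × Ch) : ℝ :=
  z (a.1, a.2, true) + z (a.1, a.2, false)

theorem sum_flow (z : Fin (n + 1) × Ch × Bool → ℝ) (k : Fin (n + 1) × Ch) :
    ∑ i, z i * flow p n i k
      = ∑ a : Fin (n + 1) × Ch, p a.2 k.2 * (z (a.1, a.2, true) * (if k.1.val = 0 then 1 else 0)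
        + z (a.1, a.2, false) * (if k.1.val = a.1.val + 1 then 1 else 0)) - mass z k := by
  rw [sum_actions]
  have : mass z k = ∑ a : Fin (n + 1) × Ch, (z (a.1, a.2, true) * (if k = (a.1, a.2) then 1 else 0)
      + z (a.1, a.2, false) * (if k = (a.1, a.2) then 1 else 0)) := by
    simp [Finset.sum_add_distrib, mass]
  rw [this, ← Finset.sum_sub_distrib]
  refine Finset.sum_congr rfl fun a _ => ?_
  simp only [flow, if_true, Bool.false_eq_true, if_false]
  ring

variable {w : Fin (n + 1) × Ch × Bool → ℝ} {E : ℝ} {z : Fin (n + 1) × Ch × Bool → ℝ}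

/-- In the sum of all balance equations every action conserves mass except waiting at the age `n +
1`, which must have frequency zero. -/
theorem IsLPFeasible.last_eq_zero (hp : p ∈ rowStochastic ℝ Ch)
    (hz : IsLPFeasible (flow p n) w E z) (q : Ch) : z (Fin.last n, q, false) = 0 := by
  have h1 : ∑ k, ∑ i, z i * flow p n i k = 0 := Finset.sum_eq_zero fun k _ => hz.eq k
  have h2 : ∀ i, ∑ k, z i * flow p n i k
      = -(z i * if i.1 = Fin.last n ∧ i.2.2 = false then 1 else 0) := by
    rintro ⟨i, q, s⟩
    have h3 := sum_mul_flow (p := p) (fun _ => (1 : ℝ)) i q s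
    simp only [one_mul, mul_one, sum_row_of_mem_rowStochastic hp] at h3
    rw [← Finset.mul_sum, h3]
    have hi := i.2
    have hl : i = Fin.last n ↔ i.val = n := by simp [Fin.ext_iff]
    cases s <;> simp only [hl]
    · by_cases h : i.val = n
      · simp [h]
      · have h' : i.val < n := by omega
        simp [h, h']
    · simp
  rw [Finset.sum_comm, Finset.sum_congr rfl fun i _ => h2 i, Finset.sum_neg_distrib, neg_eq_zero,
    Finset.sum_eq_zero_iff_of_nonneg fun i _ => by
      have := hz.nonneg i
      positivity] at h1
  simpa using h1 (Fin.last n, q, false) (Finset.mem_univ _)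

omit [DecidableEq Ch] in
theorem mass_mem_stdSimplex (h0 : ∀ i, 0 ≤ z i) (h1 : ∑ i, z i = 1) :
    mass z ∈ stdSimplex ℝ (Fin (n + 1) × Ch) :=
  ⟨fun _ => add_nonneg (h0 _) (h0 _), by rw [← h1, sum_actions]; rfl⟩

/-- The stationary policy with state-action frequencies `z`, and scheduling probabilities `d` in
the states without mass. -/
noncomputable def policyOf (z : Fin (n + 1) × Ch × Bool → ℝ) (d : ℕ → Ch → ℝ) (x : ℕ) (q : Ch) :
    ℝ :=
  if 0 < extend (mass z) x q then
    extend (fun a => z (a.1, a.2, true)) x q / extend (mass z) x q else d x q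

omit [Fintype Ch] [DecidableEq Ch] in
theorem isStationaryPolicy_policyOf (h0 : ∀ i, 0 ≤ z i) {d : ℕ → Ch → ℝ}
    (hd : IsStationaryPolicy d) : IsStationaryPolicy (policyOf z d) := by
  intro x q
  unfold policyOf
  split_ifs with h
  · have h1 : 0 ≤ extend (fun a => z (a.1, a.2, true)) x q := by
      unfold extend
      split_ifs
      exacts [h0 _, le_rfl]
    have h2 : extend (fun a => z (a.1, a.2, true)) x q ≤ extend (mass z) x q := by
      unfold extend
      split_ifs
      exacts [le_add_of_nonneg_right (h0 _), le_rfl]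
    exact ⟨div_nonneg h1 h.le, (div_le_one h).2 h2⟩
  · exact hd x q

omit [Fintype Ch] [DecidableEq Ch] in
theorem policyOf_eq_of_pos (d : ℕ → Ch → ℝ) {i : Fin (n + 1)} {q : Ch} (h : 0 < mass z (i, q)) :
    policyOf z d (i + 1) q = z (i, q, true) / mass z (i, q) := by
  simp [policyOf, h]

omit [Fintype Ch] [DecidableEq Ch] in
theorem mass_mul_policyOf (h0 : ∀ i, 0 ≤ z i) (d : ℕ → Ch → ℝ) (a : Fin (n + 1) × Ch) :
    mass z a * policyOf z d (a.1 + 1) a.2 = z (a.1, a.2, true) := by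
  obtain ⟨i, q⟩ := a
  rcases (add_nonneg (h0 (i, q, true)) (h0 (i, q, false))).eq_or_lt with h | h
  · have h1 : mass z (i, q) = 0 := h.symm
    have h2 := h0 (i, q, true)
    have h3 := h0 (i, q, false)
    rw [h1, zero_mul]
    linarith
  · have h1 : 0 < mass z (i, q) := h
    rw [policyOf_eq_of_pos d h1, mul_div_cancel₀ _ h1.ne']

omit [Fintype Ch] [DecidableEq Ch] in
theorem mass_mul_one_sub_policyOf (h0 : ∀ i, 0 ≤ z i) (d : ℕ → Ch → ℝ) (a : Fin (n + 1) × Ch) :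
    mass z a * (1 - policyOf z d (a.1 + 1) a.2) = z (a.1, a.2, false) := by
  rw [mul_sub, mass_mul_policyOf h0, mul_one, mass]
  ring

theorem IsLPFeasible.policyOf_last (hp : p ∈ rowStochastic ℝ Ch)
    (hz : IsLPFeasible (flow p n) w E z) {d : ℕ → Ch → ℝ} (hd : ∀ q, d (n + 1) q = 1) (q : Ch) :
    policyOf z d (n + 1) q = 1 := by
  have h1 : extend (mass z) (n + 1) q = mass z (Fin.last n, q) := extend_succ _ (Fin.last n) q
  have h2 : extend (fun a => z (a.1, a.2, true)) (n + 1) q = z (Fin.last n, q, true) :=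
    extend_succ _ (Fin.last n) q
  have h3 : mass z (Fin.last n, q) = z (Fin.last n, q, true) := by
    simp [mass, hz.last_eq_zero hp q]
  unfold policyOf
  rw [h1, h2, h3]
  split_ifs with h
  · exact div_self h.ne'
  · exact hd q

theorem IsLPFeasible.vecMul_mass (hz : IsLPFeasible (flow p n) w E z) (d : ℕ → Ch → ℝ) :
    mass z ᵥ* ageMatrix p (policyOf z d) n = mass z := by
  funext k
  have h1 := hz.eq k
  rw [sum_flow, sub_eq_zero] at h1
  rw [← h1]
  simp only [vecMul, dotProduct, ageMatrix]
  refine Finset.sum_congr rfl fun a _ => ?_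
  rw [← mass_mul_policyOf hz.nonneg d a, ← mass_mul_one_sub_policyOf hz.nonneg d a]
  ring

omit [DecidableEq Ch] in
theorem sum_mass_mul_meanCost (h0 : ∀ i, 0 ≤ z i) (d : ℕ → Ch → ℝ) (c : ℕ → Ch → Bool → ℝ) :
    ∑ a, mass z a * meanCost (policyOf z d) c (a.1 + 1) a.2
      = ∑ i, z i * c (i.1 + 1) i.2.1 i.2.2 := by
  rw [sum_actions]
  refine Finset.sum_congr rfl fun a _ => ?_
  rw [← mass_mul_policyOf h0 d a, ← mass_mul_one_sub_policyOf h0 d a, meanCost]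
  ring

/-- In the steady state, the mean of a function of the state is preserved by one transition. -/
theorem IsLPFeasible.sum_next (hp : p ∈ rowStochastic ℝ Ch)
    (hz : IsLPFeasible (flow p n) w E z) (F : ℕ → Ch → ℝ) :
    ∑ i, z i * (∑ r, p i.2.1 r * F (if i.2.2 then 1 else i.1.val + 1 + 1) r) =
      ∑ i, z i * F (i.1 + 1) i.2.1 := by
  -- The default `1` serves only to complete `z` to a chain; states without mass do not contribute.
  have hlast := hz.policyOf_last hp (d := fun _ _ => 1) fun _ => rfl
  have h1 := sum_mass_mul_meanCost hz.nonneg (fun _ _ => 1)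
    (fun x q s => ∑ r, p q r * F (if s then 1 else x + 1) r)
  have h2 : ∀ a : Fin (n + 1) × Ch, meanCost (policyOf z fun _ _ => 1)
      (fun x q s => ∑ r, p q r * F (if s then 1 else x + 1) r) (a.1 + 1) a.2
      = (ageMatrix p (policyOf z fun _ _ => 1) n *ᵥ fun b => F (b.1 + 1) b.2) a := by
    intro a
    rw [ageMatrix_mulVec hlast]
    simp [meanCost]
  have h3 : ∑ i, z i * F (i.1 + 1) i.2.1 = mass z ⬝ᵥ fun b => F (b.1 + 1) b.2 := by
    rw [sum_actions]
    exact Finset.sum_congr rfl fun a _ => by rw [mass]; ring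
  rw [h3, ← h1]
  conv_rhs => rw [← hz.vecMul_mass (fun _ _ => 1), ← dotProduct_mulVec]
  exact Finset.sum_congr rfl fun a _ => by rw [h2]

theorem two_mul_sum_range_sub (m : ℕ) : ∀ k ≤ m, 2 * ∑ i ∈ Finset.range m, (k - i) = k * (k + 1) := by
  induction m with
  | zero => intro k hk; simp [Nat.le_zero.1 hk]
  | succ m ih =>
    intro k hk
    cases k with
    | zero => simp
    | succ k =>
      rw [Finset.sum_range_succ', mul_add]
      simp only [Nat.add_sub_add_right, ih k (by omega), Nat.sub_zero]
      ring

/-- State-action frequencies with channel law `m`, in which the ages `1, …, k` are charged and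
carry the same transmission frequency. -/
noncomputable def spread (m : Ch → ℝ) (k : ℕ) (i : Fin (n + 1) × Ch × Bool) : ℝ :=
  2 / (k * (k + 1)) * m i.2.1 * if i.2.2 then (if i.1.val < k then 1 else 0)
    else ((k - (i.1 + 1) : ℕ) : ℝ)

omit [Fintype Ch] [DecidableEq Ch] in
theorem spread_nonneg {m : Ch → ℝ} (hm : ∀ q, 0 ≤ m q) (k : ℕ) (i : Fin (n + 1) × Ch × Bool) :
    0 ≤ spread m k i := by
  have := hm i.2.1
  unfold spread
  split_ifs <;> positivity

omit [Fintype Ch] [DecidableEq Ch] in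
theorem mass_spread (m : Ch → ℝ) (k : ℕ) (a : Fin (n + 1) × Ch) :
    mass (spread m k) a = 2 / (k * (k + 1)) * m a.2 * ((k - a.1 : ℕ) : ℝ) := by
  simp only [mass, spread, if_true, Bool.false_eq_true, if_false]
  rw [← mul_add]
  congr 1
  split_ifs with h
  · have : k - a.1.val = 1 + (k - (a.1.val + 1)) := by omega
    rw [this]
    push_cast
    ring
  · have h1 : k - a.1.val = 0 := by omega
    have h2 : k - (a.1.val + 1) = 0 := by omega
    simp [h1, h2]

omit [DecidableEq Ch] in
theorem sum_spread_true {k : ℕ} (hk : 1 ≤ k) (hkn : k ≤ n + 1) (m f : Ch → ℝ) :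
    ∑ a : Fin (n + 1) × Ch, spread m k (a.1, a.2, true) * f a.2
      = 2 / (k + 1) * ∑ q, m q * f q := by
  have h1 : ∑ i : Fin (n + 1), (if i.val < k then (1 : ℝ) else 0) = k := by
    rw [Fin.sum_univ_eq_sum_range (fun i => if i < k then (1 : ℝ) else 0), Finset.sum_boole]
    congr 1
    have : (Finset.range (n + 1)).filter (· < k) = Finset.range k := by
      ext i
      simp only [Finset.mem_filter, Finset.mem_range]
      omega
    rw [this, Finset.card_range]
  have hk0 : (k : ℝ) ≠ 0 := by positivity
  simp only [spread, if_true, Fintype.sum_prod_type]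
  rw [Finset.sum_comm]
  have h2 : ∀ q, ∑ i : Fin (n + 1), 2 / ((k : ℝ) * (k + 1)) * m q * (if i.val < k then 1 else 0) * f q
      = 2 / (k + 1) * (m q * f q) := by
    intro q
    rw [← Finset.sum_mul, ← Finset.mul_sum, h1]
    field_simp
  rw [Finset.sum_congr rfl fun q _ => h2 q, Finset.mul_sum]

/-- These are the frequencies of cycles with length uniform on `1, …, k`, independent of a channel
with law `m`. The mean cycle is `(k + 1) / 2`, hence the transmission rate `2 / (k + 1)`, small for
large `k`. -/
theorem isLPFeasible_spread {m : Ch → ℝ} (hm : m ∈ stdSimplex ℝ Ch) (hmp : m ᵥ* p = m) {k : ℕ}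
    (hk : 1 ≤ k) (hkn : k ≤ n + 1) {ω : Ch → ℝ}
    (hE : 2 / (k + 1) * ∑ q, m q * ω q ≤ E) :
    IsLPFeasible (flow p n) (fun i => powerCost ω (i.1 + 1) i.2.1 i.2.2) E (spread m k) where
  nonneg := spread_nonneg hm.1 k
  total := by
    rw [sum_actions]
    have h1 : ∀ a : Fin (n + 1) × Ch, spread m k (a.1, a.2, true) + spread m k (a.1, a.2, false)
      = 2 / (k * (k + 1)) * m a.2 * ((k - a.1 : ℕ) : ℝ) := mass_spread m k
    rw [Finset.sum_congr rfl fun a _ => h1 a, Fintype.sum_prod_type]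
    have h2 : ∀ i : Fin (n + 1), ∑ q, 2 / ((k : ℝ) * (k + 1)) * m q * ((k - i : ℕ) : ℝ)
        = 2 / ((k : ℝ) * (k + 1)) * ((k - i : ℕ) : ℝ) := by
      intro i
      rw [← Finset.sum_mul, ← Finset.mul_sum, hm.2, mul_one]
    rw [Finset.sum_congr rfl fun i _ => h2 i, ← Finset.mul_sum,
      Fin.sum_univ_eq_sum_range (fun i => ((k - i : ℕ) : ℝ)), ← Nat.cast_sum]
    have h3 := two_mul_sum_range_sub (n + 1) k hkn
    have h4 : (2 : ℝ) * ((∑ i ∈ Finset.range (n + 1), (k - i) : ℕ) : ℝ) = k * (k + 1) := by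
      exact_mod_cast h3
    rw [div_mul_eq_mul_div, h4, div_self]
    positivity
  eq := by
    rintro ⟨⟨j, hj⟩, r⟩
    have hr := congrFun hmp r
    simp only [vecMul, dotProduct] at hr
    rw [sum_flow, mass_spread, sub_eq_zero]
    cases j with
    | zero =>
      have h1 := sum_spread_true (n := n) hk hkn m fun q => p q r
      rw [hr] at h1
      have hk0 : (k : ℝ) ≠ 0 := by positivity
      simp only [if_true, mul_one, Nat.sub_zero]
      rw [show 2 / ((k : ℝ) * (k + 1)) * m r * k = 2 / (k + 1) * m r by field_simp, ← h1]
      refine Finset.sum_congr rfl fun a _ => ?_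
      simp
      ring
    | succ y =>
      simp only [Fintype.sum_prod_type]
      rw [Finset.sum_comm, ← hr, Finset.mul_sum, Finset.sum_mul]
      refine Finset.sum_congr rfl fun q _ => ?_
      have h1 := sum_ite_val_eq (n := n) (fun i => p q r * spread m k (i, q, false)) y
      rw [dif_pos (by omega)] at h1
      have h2 : p q r * spread m k ((⟨y, by omega⟩ : Fin (n + 1)), q, false)
          = 2 / ((k : ℝ) * (k + 1)) * (m q * p q r) * ((k - (y + 1) : ℕ) : ℝ) := by
        simp [spread]
        ring
      rw [← h2, ← h1]
      refine Finset.sum_congr rfl fun i _ => ?_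
      by_cases h : i.val = y
      · simp [h]
      · simp [h, Ne.symm h]
  budget := by
    rw [sum_actions]
    have := sum_spread_true (n := n) hk hkn m ω
    simp only [powerCost, if_true, Bool.false_eq_true, if_false, mul_zero, add_zero]
    rw [this]
    exact hE

end Truncated

/-! ### An optimal stopping problem -/

section Value

variable {Ch : Type*} [Fintype Ch] {p : Matrix Ch Ch ℝ} {g : ℝ} {R : ℕ → Ch → ℝ}

/-- Optimal cost of a stopping problem with stopping cost `R`, running cost `x - g` and at most `k`
steps before stopping. -/
noncomputable def stopValue (p : Matrix Ch Ch ℝ) (g : ℝ) (R : ℕ → Ch → ℝ) : ℕ → ℕ → Ch → ℝ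
  | 0, x, q => R x q
  | k + 1, x, q => min (R x q) (x - g + ∑ r, p q r * stopValue p g R k (x + 1) r)

theorem stopValue_le (k x : ℕ) (q : Ch) : stopValue p g R k x q ≤ R x q := by
  cases k with
  | zero => exact le_rfl
  | succ k => exact min_le_left _ _

/-- One age more with one step fewer keeps the last possible stopping age, while every cost rises by
at least one. This yields the slope of the certificate. -/
theorem stopValue_add_one_le [DecidableEq Ch] (hp : p ∈ rowStochastic ℝ Ch)
    (hR : ∀ x q, R (x + 1) q = R x q + 1) (k : ℕ) :
    ∀ x q, stopValue p g R (k + 1) x q + 1 ≤ stopValue p g R k (x + 1) q := by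
  induction k with
  | zero =>
    intro x q
    have := stopValue_le (p := p) (g := g) (R := R) 1 x q
    simp only [stopValue, hR] at this ⊢
    linarith
  | succ k ih =>
    intro x q
    have h1 : ∑ r, p q r * (stopValue p g R (k + 1) (x + 1) r + 1)
        ≤ ∑ r, p q r * stopValue p g R k (x + 1 + 1) r :=
      Finset.sum_le_sum fun r _ => mul_le_mul_of_nonneg_left (ih _ _)
        (nonneg_of_mem_rowStochastic hp)
    simp only [mul_add, Finset.sum_add_distrib, mul_one, sum_row_of_mem_rowStochastic hp] at h1
    rw [stopValue, ← min_add_add_right]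
    conv_rhs => rw [stopValue]
    refine min_le_min (hR x q).ge ?_
    push_cast
    linarith

end Value

/-! ### From multipliers to certificates, and attainment -/

section Optimal

variable {Ch : Type*} [Fintype Ch] [DecidableEq Ch] {p : Matrix Ch Ch ℝ} {n : ℕ}
  {ω : Ch → ℝ} {W g l E : ℝ}

/-- Multipliers of the linear program for the ages `1, …, n + 1` yield a certificate if the age
limit is not restrictive. -/
theorem exists_isCertificate (hp : p ∈ rowStochastic ℝ Ch) (hω : ∀ q, 0 ≤ ω q) (hl : 0 ≤ l)
    {V : Fin (n + 1) × Ch → ℝ}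
    (hV : ∀ i : Fin (n + 1) × Ch × Bool, g ≤ ageCost W (i.1 + 1) i.2.1 i.2.2
      + l * powerCost ω (i.1 + 1) i.2.1 i.2.2 + ∑ k, V k * flow p n i k)
    (hlarge : ∀ q r, l * ω q + g + (∑ i, p q i * V (0, i) - ∑ i, p r i * V (0, i)) ≤ n + 1) :
    ∃ Φ, IsCertificate p ω W g l Φ := by
  -- Freezing the value after a transmission at that of the multipliers leaves a stopping problem.
  -- The multipliers themselves need not increase in the age and are absent beyond `n + 1`.
  set a : Ch → ℝ := fun q => ∑ i, p q i * V (0, i) with ha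
  set R : ℕ → Ch → ℝ := fun x q => x + W + l * ω q - g + a q with hR
  have hR1 : ∀ x q, R (x + 1) q = R x q + 1 := by
    intro x q
    simp only [hR]
    push_cast
    ring
  set Φ : ℕ → Ch → ℝ := fun x q => stopValue p g R (n + 1 - x) x q with hΦ
  have hbeyond : ∀ x q, n + 1 ≤ x → Φ x q = R x q := by
    intro x q hx
    simp only [hΦ, Nat.sub_eq_zero_of_le hx, stopValue]
  have hbelow : ∀ x q, x < n + 1 → Φ x q = min (R x q) (x - g + ∑ r, p q r * Φ (x + 1) r) := by
    intro x q hx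
    obtain ⟨k, hk⟩ := Nat.exists_eq_add_of_lt hx
    have h1 : n + 1 - x = k + 1 := by omega
    have h2 : n + 1 - (x + 1) = k := by omega
    simp only [hΦ, h1, h2, stopValue]
  have hVtrue : ∀ i q, V (i, q) ≤ R (i + 1) q := by
    intro i q
    have := hV (i, q, true)
    rw [sum_mul_flow] at this
    simp only [if_true, Nat.succ_pos, dif_pos, ageCost, powerCost] at this
    simp only [hR, ha]
    change _ ≤ _ + (∑ r, p q r * V (0, r) - V (i, q)) at this
    linarith
  -- Backward induction from the age `n + 1`. At age one it bounds `a` by the mean of `Φ`, as the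
  -- inequality for transmissions requires.
  have hVle : ∀ (k : ℕ) (i : Fin (n + 1)) (q : Ch), i.val + k = n → V (i, q) ≤ Φ (i + 1) q := by
    intro k
    induction k with
    | zero =>
      intro i q hi
      rw [hbeyond _ _ (by omega)]
      exact hVtrue i q
    | succ k ih =>
      intro i q hi
      rw [hbelow _ _ (by omega)]
      refine le_min (hVtrue i q) ?_
      have h1 := hV (i, q, false)
      rw [sum_mul_flow] at h1
      simp only [Bool.false_eq_true, if_false, ageCost, powerCost, mul_zero, add_zero] at h1
      rw [dif_pos (by omega)] at h1
      have h2 : ∑ r, p q r * V (⟨i.val + 1, by omega⟩, r) ≤ ∑ r, p q r * Φ (i.val + 1 + 1) r :=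
        Finset.sum_le_sum fun r _ => mul_le_mul_of_nonneg_left
          (ih ⟨i.val + 1, by omega⟩ r (by simp only; omega)) (nonneg_of_mem_rowStochastic hp)
      linarith
  refine ⟨Φ, hl, fun x q _ => ?_, fun x q _ => ?_, fun x q _ => ?_, ∑ q, |W + l * ω q - g + a q|,
    fun x q => ?_⟩
  · have h1 : a q ≤ ∑ r, p q r * Φ 1 r := Finset.sum_le_sum fun r _ =>
      mul_le_mul_of_nonneg_left (hVle n 0 r (by simp)) (nonneg_of_mem_rowStochastic hp)
    have h2 : Φ x q ≤ R x q := stopValue_le _ _ _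
    simp only [hR] at h2
    linarith
  · rcases lt_or_ge x (n + 1) with hx | hx
    · rw [hbelow x q hx]
      exact min_le_right _ _
    -- Beyond the age limit, transmitting now must cost no more than waiting one slot and
    -- transmitting then; `hlarge` ensures this.
    · have h1 : ∑ r, p q r * (l * ω q + g + a q - (n + 1) + (x + 1 + W - g))
          ≤ ∑ r, p q r * Φ (x + 1) r := by
        refine Finset.sum_le_sum fun r _ => mul_le_mul_of_nonneg_left ?_
          (nonneg_of_mem_rowStochastic hp)
        rw [hbeyond _ _ (by omega)]
        have h2 := hlarge q r
        have h3 := mul_nonneg hl (hω r)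
        simp only [hR, ha]
        push_cast
        linarith
      rw [← Finset.sum_mul, sum_row_of_mem_rowStochastic hp, one_mul] at h1
      rw [hbeyond _ _ hx]
      simp only [hR]
      have hx' : (n : ℝ) + 1 ≤ x := by exact_mod_cast hx
      linarith
  · rcases lt_or_ge x (n + 1) with hx | hx
    · obtain ⟨k, hk⟩ := Nat.exists_eq_add_of_lt hx
      have h1 : n + 1 - x = k + 1 := by omega
      have h2 : n + 1 - (x + 1) = k := by omega
      simp only [hΦ, h1, h2]
      exact stopValue_add_one_le hp hR1 k x q
    · rw [hbeyond _ _ hx, hbeyond _ _ (by omega), hR1]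
  · have h1 : Φ x q ≤ R x q := stopValue_le _ _ _
    have h2 : |W + l * ω q - g + a q| ≤ ∑ q, |W + l * ω q - g + a q| :=
      Finset.single_le_sum (f := fun q => |W + l * ω q - g + a q|) (fun _ _ => abs_nonneg _)
        (Finset.mem_univ q)
    have h3 := le_abs_self (W + l * ω q - g + a q)
    simp only [hR] at h1
    linarith

/-- Complementary slackness. -/
theorem IsCertificate.complementary_slackness (hp : p ∈ rowStochastic ℝ Ch) {Φ : ℕ → Ch → ℝ}
    (hc : IsCertificate p ω W g l Φ) {z : Fin (n + 1) × Ch × Bool → ℝ}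
    (hz : IsLPFeasible (flow p n) (fun i => powerCost ω (i.1 + 1) i.2.1 i.2.2) E z)
    (hg : ∑ i, z i * ageCost W (i.1 + 1) i.2.1 i.2.2 + l * E ≤ g) :
    ∑ i, z i * ageCost W (i.1 + 1) i.2.1 i.2.2 = g - l * E ∧ ∀ (i : Fin (n + 1)) (q : Ch),
      z (i, q, true) * transmitLoss p ω W g l Φ (i + 1) q = 0 ∧
      z (i, q, false) * waitLoss p g Φ (i + 1) q = 0 := by
  set L : Fin (n + 1) × Ch × Bool → ℝ := fun i =>
    if i.2.2 then transmitLoss p ω W g l Φ (i.1 + 1) i.2.1 else waitLoss p g Φ (i.1 + 1) i.2.1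
    with hL
  have hterm : ∀ i, 0 ≤ z i * L i := by
    intro i
    refine mul_nonneg (hz.nonneg i) ?_
    simp only [hL]
    split_ifs
    exacts [hc.transmitLoss_nonneg (by simp) _, hc.waitLoss_nonneg (by simp) _]
  -- By stationarity the terms in `Φ` cancel. The budget and `hg` then make the total loss
  -- nonpositive.
  have hsum : ∑ i, z i * L i = ∑ i, z i * ageCost W (i.1 + 1) i.2.1 i.2.2
      + l * ∑ i, z i * powerCost ω (i.1 + 1) i.2.1 i.2.2 - g := by
    have h1 := hz.sum_next hp Φ
    have h2 : ∀ i, z i * L i = z i * ageCost W (i.1 + 1) i.2.1 i.2.2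
        + l * (z i * powerCost ω (i.1 + 1) i.2.1 i.2.2) - z i * g
        + (z i * (∑ r, p i.2.1 r * Φ (if i.2.2 then 1 else i.1.val + 1 + 1) r)
          - z i * Φ (i.1 + 1) i.2.1) := by
      rintro ⟨i, q, s⟩
      cases s
      · simp only [hL, waitLoss, ageCost, powerCost, Bool.false_eq_true, if_false]
        ring
      · simp only [hL, transmitLoss, ageCost, powerCost, if_true]
        ring
    rw [Finset.sum_congr rfl fun i _ => h2 i, Finset.sum_add_distrib, Finset.sum_sub_distrib,
      Finset.sum_sub_distrib, Finset.sum_add_distrib, ← Finset.mul_sum, ← Finset.sum_mul, hz.total,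
      h1]
    ring
  have hpow := mul_le_mul_of_nonneg_left hz.budget hc.price_nonneg
  have hnn : 0 ≤ ∑ i, z i * L i := Finset.sum_nonneg fun i _ => hterm i
  have hzero : ∑ i, z i * L i = 0 := by linarith
  have hall := (Finset.sum_eq_zero_iff_of_nonneg fun i _ => hterm i).1 hzero
  refine ⟨by linarith, fun i q => ⟨?_, ?_⟩⟩
  · simpa [hL] using hall (i, q, true) (Finset.mem_univ _)
  · simpa [hL] using hall (i, q, false) (Finset.mem_univ _)

omit [DecidableEq Ch] in
theorem sum_spread_ageCost_le {m : Ch → ℝ} (hm : ∀ q, 0 ≤ m q) (hW : 0 ≤ W) {k : ℕ}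
    (htot : ∑ i : Fin (n + 1) × Ch × Bool, spread m k i = 1) :
    ∑ i : Fin (n + 1) × Ch × Bool, spread m k i * ageCost W (i.1 + 1) i.2.1 i.2.2 ≤ k + W := by
  have h1 : ∀ i : Fin (n + 1) × Ch × Bool, spread m k i * ageCost W (i.1 + 1) i.2.1 i.2.2
      ≤ spread m k i * (k + W) := by
    rintro ⟨i, q, s⟩
    rcases lt_or_ge i.val k with hi | hi
    · refine mul_le_mul_of_nonneg_left ?_ (spread_nonneg hm _ _)
      have : (i.val : ℝ) + 1 ≤ k := by exact_mod_cast hi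
      simp only [ageCost]
      push_cast
      split_ifs <;> linarith
    · have h0 : spread m k (i, q, s) = 0 := by
        have h2 : k - (i.val + 1) = 0 := by omega
        simp [spread, not_lt.2 hi, h2]
      simp [h0]
  refine (Finset.sum_le_sum fun i _ => h1 i).trans ?_
  rw [← Finset.sum_mul, htot, one_mul]

/-- An optimal solution of the linear program, a matching certificate, and a feasible solution that
charges all transmissions. -/
theorem exists_optimal_frequencies [Nonempty Ch] (hp : p ∈ rowStochastic ℝ Ch)
    (hirr : p.IsIrreducible) (hω : ∀ q, 0 ≤ ω q) (hE : 0 < E) (hW : 0 ≤ W) :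
    ∃ (n : ℕ) (z z' : Fin (n + 1) × Ch × Bool → ℝ) (g l : ℝ) (Φ : ℕ → Ch → ℝ),
      IsCertificate p ω W g l Φ ∧
      IsLPFeasible (flow p n) (fun i => powerCost ω (i.1 + 1) i.2.1 i.2.2) E z ∧
      IsLPFeasible (flow p n) (fun i => powerCost ω (i.1 + 1) i.2.1 i.2.2) E z' ∧
      (∀ i q, 0 < z' (i, q, true)) ∧
      ∑ i, z i * ageCost W (i.1 + 1) i.2.1 i.2.2 + l * E ≤ g := by
  obtain ⟨m, hm, hmp, hmpos⟩ := exists_pos_stationary hp hirr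
  obtain ⟨K, hK0, hK⟩ := exists_oscillation_bound hp hirr
  set Ω : ℝ := ∑ q, ω q with hΩ
  have hωΩ : ∀ q, ω q ≤ Ω := fun q =>
    Finset.single_le_sum (fun q _ => hω q) (Finset.mem_univ q)
  have hΩ0 : 0 ≤ Ω := Finset.sum_nonneg fun q _ => hω q
  have hmω : ∑ q, m q * ω q ≤ Ω := by
    have : ∑ q, m q * ω q ≤ ∑ q, m q * Ω :=
      Finset.sum_le_sum fun q _ => mul_le_mul_of_nonneg_left (hωΩ q) (hm.1 q)
    rwa [← Finset.sum_mul, hm.2, one_mul] at this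
  -- With this `k`, `spread m (k + 1)` uses at most half of the budget: a Slater point.
  obtain ⟨k, hk⟩ := exists_nat_ge (4 * Ω / E)
  have hpower : ∀ j : ℕ, k + 1 ≤ j → 2 / ((j : ℝ) + 1) * ∑ q, m q * ω q ≤ E / 2 := by
    intro j hj
    have hj' : (k : ℝ) + 1 ≤ j := by exact_mod_cast hj
    rw [div_le_iff₀ hE] at hk
    rw [div_mul_eq_mul_div, div_le_iff₀ (by positivity)]
    nlinarith
  -- `A` bounds the cost of the Slater point. The later bounds on `l`, `g` and the oscillation of
  -- `V` involve `A` but not `n`, so `n` can be chosen in terms of them.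
  set A : ℝ := (k + 1 : ℕ) + W with hA
  have hA0 : 0 ≤ A := by positivity
  obtain ⟨n₀, hn₀⟩ := exists_nat_ge (2 * A / E * Ω + 2 * A + K * (1 + W + 2 * A / E * Ω))
  set n := max n₀ k with hn
  have hkn : k + 1 ≤ n + 1 := by omega
  have hnn₀ : (n₀ : ℝ) ≤ n := by exact_mod_cast le_max_left n₀ k
  have hslater := isLPFeasible_spread (n := n) (p := p) hm hmp (by omega) hkn (hpower _ le_rfl)
  have hfull := isLPFeasible_spread (n := n) (p := p) hm hmp (by omega) le_rfl
    ((hpower _ hkn).trans (half_le_self hE.le))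
  obtain ⟨z, hz, hmin⟩ := hfull.exists_minimizer fun i => ageCost W (i.1 + 1) i.2.1 i.2.2
  obtain ⟨V, g, l, hl, hg, hV⟩ := IsLPFeasible.exists_multipliers hmin
  have hcost0 : 0 ≤ ∑ i, z i * ageCost W (i.1 + 1) i.2.1 i.2.2 := by
    refine Finset.sum_nonneg fun i _ => mul_nonneg (hz.nonneg i) ?_
    simp only [ageCost]
    split_ifs <;> positivity
  -- Averaging the dual inequality over the Slater point eliminates `V`. Together with `l * E ≤ g`,
  -- the spare half of the budget bounds `l`.
  have hgA : g ≤ A + l * (E / 2) := by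
    have h1 : ∑ i, spread m (k + 1) i * g ≤ ∑ i, spread m (k + 1) i
        * (ageCost W (i.1 + 1) i.2.1 i.2.2 + l * powerCost ω (i.1 + 1) i.2.1 i.2.2
          + ∑ k, V k * flow p n i k) :=
      Finset.sum_le_sum fun i _ => mul_le_mul_of_nonneg_left (hV i) (hslater.nonneg i)
    have h2 : ∑ i, spread m (k + 1) i * ∑ k, V k * flow p n i k = 0 := by
      simp only [Finset.mul_sum]
      rw [Finset.sum_comm]
      refine Finset.sum_eq_zero fun j _ => ?_
      have := hslater.eq j
      rw [Finset.sum_congr rfl fun i _ =>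
        show spread m (k + 1) i * (V j * flow p n i j) = V j * (spread m (k + 1) i * flow p n i j)
          by ring, ← Finset.mul_sum, this, mul_zero]
    have h3 : ∑ i : Fin (n + 1) × Ch × Bool, spread m (k + 1) i * (l * powerCost ω (i.1 + 1) i.2.1 i.2.2)
        = l * ∑ i : Fin (n + 1) × Ch × Bool, spread m (k + 1) i * powerCost ω (i.1 + 1) i.2.1 i.2.2 := by
      rw [Finset.mul_sum]
      exact Finset.sum_congr rfl fun _ _ => by ring
    rw [← Finset.sum_mul, hslater.total, one_mul] at h1
    simp only [mul_add, Finset.sum_add_distrib, h2, h3] at h1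
    have h4 := sum_spread_ageCost_le hm.1 hW hslater.total
    have h5 := mul_le_mul_of_nonneg_left hslater.budget hl
    simp only [hA]
    linarith
  have hlA : l ≤ 2 * A / E := by
    rw [le_div_iff₀ hE]
    linarith
  have hg2A : g ≤ 2 * A := by
    rw [le_div_iff₀ hE] at hlA
    linarith
  have hg0 : 0 ≤ g := by
    have := mul_nonneg hl hE.le
    linarith
  have hlω : ∀ q, l * ω q ≤ 2 * A / E * Ω := fun q =>
    mul_le_mul hlA (hωΩ q) (hω q) (hl.trans hlA)
  have hosc := hK (1 + W + 2 * A / E * Ω) (fun q => V (0, q)) (by positivity) (by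
    intro q
    have h1 := hV (0, q, true)
    rw [sum_mul_flow] at h1
    simp only [if_true, Nat.succ_pos, dif_pos, ageCost, powerCost, Fin.val_zero, zero_add,
      Nat.cast_one] at h1
    change _ ≤ _ + (∑ r, p q r * V (0, r) - V (0, q)) at h1
    have h2 := hlω q
    linarith)
  have hosc' : ∀ q r, ∑ i, p q i * V (0, i) - ∑ i, p r i * V (0, i)
      ≤ K * (1 + W + 2 * A / E * Ω) := by
    intro q r
    have h1 : ∀ j, ∑ i, p q i * V (0, i) ≤ V (0, j) + K * (1 + W + 2 * A / E * Ω) := by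
      intro j
      have : ∑ i, p q i * V (0, i)
          ≤ ∑ i, p q i * (V (0, j) + K * (1 + W + 2 * A / E * Ω)) :=
        Finset.sum_le_sum fun i _ => mul_le_mul_of_nonneg_left (by linarith [hosc i j])
          (nonneg_of_mem_rowStochastic hp)
      rwa [← Finset.sum_mul, sum_row_of_mem_rowStochastic hp, one_mul] at this
    have h2 : ∑ j, p r j * (∑ i, p q i * V (0, i))
        ≤ ∑ j, p r j * (V (0, j) + K * (1 + W + 2 * A / E * Ω)) :=
      Finset.sum_le_sum fun j _ => mul_le_mul_of_nonneg_left (h1 j)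
        (nonneg_of_mem_rowStochastic hp)
    simp only [mul_add (p r _), Finset.sum_add_distrib, ← Finset.sum_mul,
      sum_row_of_mem_rowStochastic hp, one_mul] at h2
    linarith
  obtain ⟨Φ, hΦ⟩ := exists_isCertificate (p := p) (ω := ω) (W := W) hp hω hl hV (by
    intro q r
    have h1 := hosc' q r
    have h2 := hlω q
    linarith)
  refine ⟨n, z, spread m (n + 1), g, l, Φ, hΦ, hz, hfull, fun i q => ?_, hg⟩
  have h1 := i.2
  have h2 := hmpos q
  simp only [spread, if_true, h1]
  positivity

theorem IsLPFeasible.mix {ι κ : Type*} [Fintype ι] {R : ι → κ → ℝ} {w : ι → ℝ} {E : ℝ}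
    {z z' : ι → ℝ} (hz : IsLPFeasible R w E z) (hz' : IsLPFeasible R w E z') {ε : ℝ} (hε0 : 0 ≤ ε)
    (hε1 : ε ≤ 1) : IsLPFeasible R w E fun i => (1 - ε) * z i + ε * z' i := by
  have hlin : ∀ f : ι → ℝ, ∑ i, ((1 - ε) * z i + ε * z' i) * f i
      = (1 - ε) * ∑ i, z i * f i + ε * ∑ i, z' i * f i := by
    intro f
    rw [Finset.mul_sum, Finset.mul_sum, ← Finset.sum_add_distrib]
    exact Finset.sum_congr rfl fun i _ => by ring
  refine ⟨fun i => ?_, ?_, fun k => ?_, ?_⟩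
  · exact add_nonneg (mul_nonneg (sub_nonneg.2 hε1) (hz.nonneg i)) (mul_nonneg hε0 (hz'.nonneg i))
  · have := hlin fun _ => 1
    simp only [mul_one, hz.total, hz'.total] at this
    rw [this]
    ring
  · rw [hlin, hz.eq, hz'.eq]
    ring
  · rw [hlin]
    have h1 := mul_le_mul_of_nonneg_left hz.budget (sub_nonneg.2 hε1)
    have h2 := mul_le_mul_of_nonneg_left hz'.budget hε0
    linarith

omit [DecidableEq Ch] in
theorem longRun_eq_of_tendsto {ν : Ch → ℝ} {π : Rule Ch} {c : ℕ → Ch → Bool → ℝ} {a : ℝ}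
    (h : Tendsto (expAverage p ν π c) atTop (𝓝 a)) : longRun p ν π c = (a : EReal) :=
  Tendsto.limsup_eq ((continuous_coe_real_ereal.tendsto a).comp h)

/-- Long-run averages under the stationary policy with state-action frequencies `z`, if its
stationary distribution is unique. -/
theorem IsLPFeasible.longRun_policyOf (hp : p ∈ rowStochastic ℝ Ch)
    {w : Fin (n + 1) × Ch × Bool → ℝ} {z : Fin (n + 1) × Ch × Bool → ℝ}
    (hz : IsLPFeasible (flow p n) w E z) {d : ℕ → Ch → ℝ} (hd : IsStationaryPolicy d)
    (hdlast : ∀ q, d (n + 1) q = 1)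
    (huniq : ∀ m' ∈ stdSimplex ℝ (Fin (n + 1) × Ch),
      m' ᵥ* ageMatrix p (policyOf z d) n = m' → m' = mass z)
    {ν : Ch → ℝ} (hν : ν ∈ stdSimplex ℝ Ch) (c : ℕ → Ch → Bool → ℝ) :
    longRun p ν (stationary (policyOf z d)) c
      = ((∑ i, z i * c (i.1 + 1) i.2.1 i.2.2 : ℝ) : EReal) := by
  rw [← sum_mass_mul_meanCost hz.nonneg d c]
  exact longRun_eq_of_tendsto (tendsto_expAverage hp (isStationaryPolicy_policyOf hz.nonneg hd)
    (hz.policyOf_last hp hdlast) huniq hν c)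

/-- State-action frequencies that charge every transmission are realized, for every initial law,
by a stationary policy. -/
theorem IsLPFeasible.exists_policy [Nonempty Ch] (hp : p ∈ rowStochastic ℝ Ch)
    (hirr : p.IsIrreducible) {z : Fin (n + 1) × Ch × Bool → ℝ}
    (hz : IsLPFeasible (flow p n) (fun i => powerCost ω (i.1 + 1) i.2.1 i.2.2) E z)
    (hpos : ∀ i q, 0 < z (i, q, true)) {ν : Ch → ℝ} (hν : ν ∈ stdSimplex ℝ Ch) :
    ∃ π, IsFeasible p ω E ν π ∧ longRun p ν π (ageCost W)
      = ((∑ i, z i * ageCost W (i.1 + 1) i.2.1 i.2.2 : ℝ) : EReal) := by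
  have hd : IsStationaryPolicy fun (_ : ℕ) (_ : Ch) => (1 : ℝ) := fun _ _ => ⟨zero_le_one, le_rfl⟩
  have hξ := isStationaryPolicy_policyOf hz.nonneg hd
  have hξpos : ∀ x q, 1 ≤ x → 0 < policyOf z (fun _ _ => 1) x q := by
    intro x q hx
    by_cases h : x ≤ n + 1
    · obtain ⟨y, rfl⟩ := Nat.exists_eq_add_of_le' hx
      have hm : 0 < mass z (⟨y, by omega⟩, q) := add_pos_of_pos_of_nonneg (hpos _ _) (hz.nonneg _)
      rw [policyOf_eq_of_pos (i := ⟨y, by omega⟩) _ hm]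
      exact div_pos (hpos _ _) hm
    · rw [policyOf, extend_of_lt _ (by omega), if_neg (lt_irrefl _)]
      exact one_pos
  have hlr := hz.longRun_policyOf hp hd (fun _ => rfl) (fun m' hm' hmM' =>
    stationary_unique_of_pos hp hirr hξ (hz.policyOf_last hp fun _ => rfl) hξpos
      (mass_mem_stdSimplex hz.nonneg hz.total) hm' (hz.vecMul_mass _) hmM') hν
  refine ⟨stationary (policyOf z fun _ _ => 1), ⟨fun _ x q => hξ x q, ?_⟩, hlr _⟩
  rw [hlr]
  exact EReal.coe_le_coe_iff.2 hz.budget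

/-- A policy built from `z` alone may fail to realize `z` from `ν`. A share `ε` of `z'` repairs this
and changes the cost by `ε * (C' - C)`, with `ε` arbitrarily small. -/
theorem longRun_le_of_isOptimal [Nonempty Ch] (hp : p ∈ rowStochastic ℝ Ch)
    (hirr : p.IsIrreducible) {z z' : Fin (n + 1) × Ch × Bool → ℝ}
    (hz : IsLPFeasible (flow p n) (fun i => powerCost ω (i.1 + 1) i.2.1 i.2.2) E z)
    (hz' : IsLPFeasible (flow p n) (fun i => powerCost ω (i.1 + 1) i.2.1 i.2.2) E z')
    (hpos : ∀ i q, 0 < z' (i, q, true)) {ν : Ch → ℝ} (hν : ν ∈ stdSimplex ℝ Ch) {π : Rule Ch}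
    (hπ : IsOptimal p ω E W ν π) : longRun p ν π (ageCost W)
      ≤ ((∑ i, z i * ageCost W (i.1 + 1) i.2.1 i.2.2 : ℝ) : EReal) := by
  by_contra hlt
  push Not at hlt
  obtain ⟨r, hr, hr'⟩ := EReal.lt_iff_exists_real_btwn.1 hlt
  rw [EReal.coe_lt_coe_iff] at hr
  set C := ∑ i, z i * ageCost W (i.1 + 1) i.2.1 i.2.2 with hC
  set C' := ∑ i, z' i * ageCost W (i.1 + 1) i.2.1 i.2.2 with hC'
  set D : ℝ := |C' - C| + 1 with hD
  have hD0 : 0 < D := by positivity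
  set ε : ℝ := min 1 ((r - C) / D) with hε
  have hε0 : 0 < ε := lt_min one_pos (div_pos (sub_pos.2 hr) hD0)
  have hε1 : ε ≤ 1 := min_le_left _ _
  have hεD : ε * D ≤ r - C := by
    rw [← le_div_iff₀ hD0]
    exact min_le_right _ _
  obtain ⟨π', hπ', hcost⟩ := (hz.mix hz' hε0.le hε1).exists_policy (W := W) hp hirr (fun i q =>
    add_pos_of_nonneg_of_pos (mul_nonneg (sub_nonneg.2 hε1) (hz.nonneg _))
      (mul_pos hε0 (hpos i q))) hν
  have h1 := hπ.le π' hπ'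
  have h2 : ∑ i, ((1 - ε) * z i + ε * z' i) * ageCost W (i.1 + 1) i.2.1 i.2.2
      = C + ε * (C' - C) := by
    have : C + ε * (C' - C) = (1 - ε) * C + ε * C' := by ring
    rw [this, hC, hC', Finset.mul_sum, Finset.mul_sum, ← Finset.sum_add_distrib]
    exact Finset.sum_congr rfl fun i _ => by ring
  rw [hcost, h2] at h1
  have h3 : C + ε * (C' - C) ≤ r := by
    have := mul_le_mul_of_nonneg_left (le_abs_self (C' - C)) hε0.le
    simp only [hD] at hεD
    linarith
  exact absurd (hr'.trans_le (h1.trans (EReal.coe_le_coe_iff.2 h3))) (lt_irrefl _)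

end Optimal

end AoI

/-! ### Monotonicity of optimal policies -/

theorem corollary2 {Ch : Type*} [Fintype Ch] [DecidableEq Ch] [Nonempty Ch]
    (p : Matrix Ch Ch ℝ) (hp : p ∈ Matrix.rowStochastic ℝ Ch) (hirr : p.IsIrreducible)
    (ω : Ch → ℝ) (hω : ∀ q, 0 ≤ ω q) (E : ℝ) (hE : 0 < E) (W : ℝ) (hW : 0 ≤ W) :
    -- every optimal stationary randomized policy is nondecreasing on the states that it visits
    -- with positive long-run frequency
    (∀ ν ∈ stdSimplex ℝ Ch, ∀ ξ : ℕ → Ch → ℝ, AoI.IsStationaryPolicy ξ →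
      AoI.IsOptimal p ω E W ν (AoI.stationary ξ) →
      ∀ (q : Ch) (x₁ x₂ : ℕ), 1 ≤ x₁ → x₁ < x₂ →
        0 < AoI.longRun p ν (AoI.stationary ξ) (AoI.visit x₁ q) →
        0 < AoI.longRun p ν (AoI.stationary ξ) (AoI.visit x₂ q) →
        ξ x₁ q ≤ ξ x₂ q) ∧
    -- there is an optimal stationary randomized policy that is nondecreasing on all states
    (∃ ξ μ : ℕ → Ch → ℝ, AoI.IsStationaryPolicy ξ ∧ AoI.IsSteadyOptimal p ω E W ξ μ ∧
      ((∀ μ', AoI.IsSteadyState p ξ μ' → μ' = μ) →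
        ∀ ν ∈ stdSimplex ℝ Ch, AoI.IsOptimal p ω E W ν (AoI.stationary ξ)) ∧
      ∀ (q : Ch) (x₁ x₂ : ℕ), 1 ≤ x₁ → x₁ < x₂ → ξ x₁ q ≤ ξ x₂ q) := by
  open AoI in
  obtain ⟨n, z, z', g, l, Φ, hcert, hz, hz', hpos, hg⟩ :=
    exists_optimal_frequencies hp hirr hω hE hW
  obtain ⟨hcost, hslack⟩ := hcert.complementary_slackness hp hz hg
  refine ⟨fun ν hν ξ hξ hopt q x₁ x₂ hx₁ hx hv₁ hv₂ => ?_, ?_⟩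
  · have hle := longRun_le_of_isOptimal hp hirr hz hz' hpos hν hopt
    rw [hcost] at hle
    have h₁ := (hcert.loss_eq_zero hp hW hν hopt.feasible hle hx₁ hv₁).1
    have h₂ := (hcert.loss_eq_zero hp hW hν hopt.feasible hle (by omega) hv₂).2
    have hanti := hcert.loss_strictAnti hp q hx₁ hx
    have hW₁ := hcert.waitLoss_nonneg hx₁ q
    have hT₂ := hcert.transmitLoss_nonneg (by omega : 1 ≤ x₂) q
    -- If `ξ x₁ q ≠ 0` and `ξ x₂ q ≠ 1`, transmitting is lossless at `x₁` and waiting at `x₂`,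
    -- against the strict decrease of the loss difference.
    rcases mul_eq_zero.1 h₁ with h | h
    · rw [h]
      exact (hξ x₂ q).1
    rcases mul_eq_zero.1 h₂ with h' | h'
    · linarith [(hξ x₁ q).2]
    · linarith
  -- States without mass take an action of least loss; transmitting from the age `n + 1` on keeps
  -- the chain in the truncated range.
  · set d : ℕ → Ch → ℝ := fun x q =>
      if n + 1 ≤ x ∨ transmitLoss p ω W g l Φ x q ≤ waitLoss p g Φ x q then 1 else 0 with hd
    have hdpol : IsStationaryPolicy d := by
      intro x q
      simp only [hd]
      split_ifs <;> simp
    have hdlarge : ∀ x q, n + 1 ≤ x → d x q = 1 := fun x q hx => if_pos (Or.inl hx)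
    have hξ := isStationaryPolicy_policyOf hz.nonneg hdpol
    have hlast := hz.policyOf_last hp fun q => hdlarge (n + 1) q le_rfl
    have hsupp : ∀ x q, ¬(1 ≤ x ∧ x ≤ n + 1) → extend (mass z) x q = 0 := fun x q h => dif_neg h
    refine ⟨policyOf z d, extend (mass z), hξ, ⟨?_, ⟨_, ?_, hz.budget⟩, g - l * E, ?_,
      fun ν hν π hπ => hcert.le_longRun hp hW hν hπ⟩, fun huniq ν hν => ?_, ?_⟩
    · exact isSteadyState_extend hlast (mass_mem_stdSimplex hz.nonneg hz.total) (hz.vecMul_mass d)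
    · rw [← sum_mass_mul_meanCost hz.nonneg d (powerCost ω)]
      convert hasSum_of_support (n := n)
        (F := fun s : ℕ × Ch => extend (mass z) s.1 s.2 * policyOf z d s.1 s.2 * ω s.2)
        (fun x q h => by simp [hsupp x q h]) using 1
      refine Finset.sum_congr rfl fun a _ => ?_
      simp only [extend_succ, meanCost, powerCost, if_true, Bool.false_eq_true, if_false]
      ring
    · rw [← hcost, ← sum_mass_mul_meanCost hz.nonneg d (ageCost W)]
      convert hasSum_of_support (n := n)
        (F := fun s : ℕ × Ch => extend (mass z) s.1 s.2 * ((s.1 : ℝ) + W * policyOf z d s.1 s.2))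
        (fun x q h => by simp [hsupp x q h]) using 1
      refine Finset.sum_congr rfl fun a _ => ?_
      simp only [extend_succ, meanCost, ageCost, if_true, Bool.false_eq_true, if_false]
      ring
    -- Invariant laws of the truncated chain extend to steady states, so uniqueness passes to the
    -- finite chain.
    · have hlr := hz.longRun_policyOf hp hdpol (fun q => hdlarge (n + 1) q le_rfl)
        (fun m' hm' hmM' => by
          have h := huniq _ (isSteadyState_extend hlast hm' hmM')
          funext a
          have := congrFun (congrFun h (a.1 + 1)) a.2
          simpa using this) hν
      refine ⟨⟨fun _ x q => hξ x q, ?_⟩, fun π hπ => ?_⟩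
      · rw [hlr]
        exact EReal.coe_le_coe_iff.2 hz.budget
      · rw [hlr, hcost]
        exact hcert.le_longRun hp hW hν hπ
    · intro q x₁ x₂ hx₁ hx
      rcases lt_or_ge x₂ (n + 1) with hx₂ | hx₂
      -- Either waiting loses more at `x₂`, where the probability is then `1`, or transmitting loses
      -- more at `x₁`, where it is `0`. Slackness settles states with mass, `d` the others.
      · rcases lt_or_ge (transmitLoss p ω W g l Φ x₂ q) (waitLoss p g Φ x₂ q) with hlt | hge
        · have hw : waitLoss p g Φ x₂ q ≠ 0 :=
            ((hcert.transmitLoss_nonneg (by omega) q).trans_lt hlt).ne'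
          have h1 : policyOf z d x₂ q = 1 := by
            obtain ⟨y, rfl⟩ := Nat.exists_eq_add_of_le' (hx₁.trans hx.le)
            by_cases hm : 0 < mass z (⟨y, by omega⟩, q)
            · have h0 := (mul_eq_zero.1 (hslack ⟨y, by omega⟩ q).2).resolve_right hw
              rw [policyOf_eq_of_pos (i := ⟨y, by omega⟩) d hm, div_eq_one_iff_eq hm.ne', mass, h0,
                add_zero]
            · have h2 := extend_succ (mass z) ⟨y, by omega⟩ q
              simp only at h2
              rw [policyOf, h2, if_neg hm]
              exact if_pos (Or.inr hlt.le)
          rw [h1]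
          exact (hξ x₁ q).2
        · have hanti := hcert.loss_strictAnti hp q hx₁ hx
          have hw := hcert.waitLoss_nonneg hx₁ q
          have ht : transmitLoss p ω W g l Φ x₁ q ≠ 0 := by linarith
          have h1 : policyOf z d x₁ q = 0 := by
            obtain ⟨y, rfl⟩ := Nat.exists_eq_add_of_le' hx₁
            by_cases hm : 0 < mass z (⟨y, by omega⟩, q)
            · have h0 := (mul_eq_zero.1 (hslack ⟨y, by omega⟩ q).1).resolve_right ht
              rw [policyOf_eq_of_pos (i := ⟨y, by omega⟩) d hm, h0, zero_div]
            · have h2 := extend_succ (mass z) ⟨y, by omega⟩ q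
              simp only at h2
              rw [policyOf, h2, if_neg hm]
              refine if_neg (not_or.2 ⟨by omega, ?_⟩)
              linarith
          rw [h1]
          exact (hξ x₂ q).1
      · have h1 : policyOf z d x₂ q = 1 := by
          rcases hx₂.eq_or_lt with h | h
          · rw [← h]
            exact hlast q
          · rw [policyOf, extend_of_lt _ h, if_neg (lt_irrefl _)]
            exact hdlarge _ _ hx₂
        rw [h1]
        exact (hξ x₁ q).2
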